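/- **Setting.** Let $A,A_1\in\mathbb R^{n\times n}$, $B\in\mathbb R^{n\times 1}$, $a,a_2\in\mathbb R$, $\bar u>0$, and let gains $K\in\mathbb R^{1\times n}$, $c>0$ be given. $|\cdot|$ is the Euclidean norm, $\|\cdot\|$ the norm of $L^2(0,1)$, $\mathcal H=\mathbb R^n\times L^2(0,1)$ with $\|(X,v)\|_{\mathcal H}^2=|X|^2+\|v\|^2$, and $\mathrm{sat}(U,\bar u)=\mathrm{sign}(U)\min(|U|,\bar u)$. Put $$\gamma(x)=[K\ \ 0]\,e^{\left[\begin{smallmatrix}0&A-aI\\ I&0\end{smallmatrix}\right]x}\left[\begin{smallmatrix}I\\0\end{smallmatrix}\right],\qquad \psi(x)=[K\ \ 0]\,e^{\left[\begin{smallmatrix}0&A+BK-aI\\ I&0\end{smallmatrix}\right]x}\left[\begin{smallmatrix}I\\0\end{smallmatrix}\right],$$ $$k(x,y)=\int_0^{x-y}\gamma(\sigma)B\,d\sigma,\qquad n(x,y)=\int_0^{x-y}\psi(\sigma)B\,d\sigma,$$ $$q(x,y)=-(a+c)x\,\frac{I_1(\sqrt{(a+c)(x^2-y^2)})}{\sqrt{(a+c)(x^2-y^2)}},\qquad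 l(x,y)=-(a+c)x\,\frac{J_1(\sqrt{(a+c)(x^2-y^2)})}{\sqrt{(a+c)(x^2-y^2)}},$$ where $J_1$, $I_1$ are the (modified) Bessel functions of order one and the quotients $I_1(s)/s$, $J_1(s)/s$ are understood as power series in $s^2$ (so that $q,l$ are defined for $x=y$ and for every sign of $a+c$). All maxima of $|k|,|q|,|l|$ below without further indication are over $0\le y\le x\le 1$, and $\max|\gamma|$ is over $[0,1]$. The feedback is $$U(X,u)=\int_0^1k(1,y)u(y)\,dy+\gamma(1)X+\int_0^1q(1,y)\Big[u(y)-\int_0^yk(y,s)u(s)\,ds-\gamma(y)X\Big]dy .$$ Put $\zeta=(1+\max|q|)^2(\max|\gamma|)^2$, $c_1=|\psi(1)|$, $c_2=\max_{0\le y\le1}|n(1,y)|\,(1+\max|l|)+\max_{0\le y\le 1}|l(1,y)|$, $M_1=1+2[\max|\gamma|(1+\max|q|)]^2$, $M_2=2(1+\max|k|)^2(1+\max|q|)^2$. For $h>0$ let $W_1=C([-h,0],D(\mathcal A_u))\cap C^1([-h,0],\mathcal H)$, where $D(\mathcal A_u)=\{(X,u)\in\mathbb R^n\times H^2(0,1):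 u'(0)=0,\ u(1)=U(X,u)\}$ carries the norm of $\mathbb R^n\times H^2(0,1)$, and for $\beta>0$ let $$\mathcal X_u=\Big\{(X_0,u_0)\in W_1:\ M_1\max_{[-h,0]}|X_0|^2+M_2\max_{[-h,0]}\|u_0\|^2\le\beta^{-1}\Big\}.$$ For $\tau:[0,\infty)\to(0,h]$, a *classical solution* with initial functions $(X_0,u_0)$ of the saturated closed loop $$\begin{cases}\dot X(t)=AX(t)+A_1X(t-\tau(t))+Bu(0,t),\\ u_t(x,t)=u_{xx}(x,t)+a_2u(x,t-\tau(t))+au(x,t),\quad 0<x<1,\\ u_x(0,t)=0,\qquad u(1,t)=\mathrm{sat}\big(U(X(t),u(\cdot,t)),\bar u\big),\end{cases}$$ is a pair $(X,u)$ defined for $t\ge-h$ that equals $(X_0,u_0)$ on $[-h,0]$, is of class $C^1$ on $[0,\infty)$ with values in $\mathcal H$, has $u(\cdot,t)\in H^2(0,1)$ for $t\ge 0$, and satisfies the differential equations and $u_x(0,t)=0$ for all $t\ge0$ (in $\mathcal H$, one-sided time derivative at $t=0$) and the boundary condition at $x=1$ for all $t>0$. **Theorem.** Let $r>0$, $\delta_1=\delta_0>0$,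 and let there exist a symmetric positive definite $P\in\mathbb R^{n\times n}$ and scalars $\beta>0$, $p_1>0$, $0\le\lambda\le2p_1$ such that $$\begin{bmatrix}\theta_{11}&PA_1&PB\\ *&-2\delta_1P+p_1r^{-1}\zeta(A_1-a_2I)^\top(A_1-a_2I)&0\\ *&*&-\lambda\end{bmatrix}<0,\qquad \theta_{11}=P(A+BK)+(A+BK)^\top P+2\delta_0P,$$ $$\begin{bmatrix}\left(-2c+2\delta_0+r-\tfrac{\pi^2}{2}\right)p_1+\tfrac{\pi^2}{4}\lambda&a_2p_1\\ *&-2\delta_1p_1\end{bmatrix}<0,$$ $$P\le\beta I,\qquad p_1\le\beta,\qquad \tfrac{\bar u^2}{2}P-c_1^2I\ge0,\qquad \tfrac{\bar u^2}{2}p_1-c_2^2\ge0 .$$ Then for all $h_0>0$ and $h>0$, all continuously differentiable delays $\tau:[0,\infty)\to\mathbb R$ with $h_0\le\tau(t)\le h$, and all initial functions $(X_0,u_0)\in\mathcal X_u$, every classical solution of the saturated closed loop with initial functions $(X_0,u_0)$ satisfies $$\lim_{t\to\infty}\|(X(t),u(\cdot,t))\|_{\mathcal H}=0 ;$$ in this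 sense $\mathcal X_u$ is an estimate of the domain of attraction. -/

import Mathlib

open Set Filter Topology MeasureTheory

namespace HeatODE

noncomputable section

/-! ### State spaces -/

/-- Euclidean space `ℝⁿ`. -/
abbrev E (n : ℕ) : Type := EuclideanSpace ℝ (Fin n)

/-- Lebesgue measure on `(0,1)`. -/
abbrev μ₀₁ : Measure ℝ := volume.restrict (Ioo (0 : ℝ) 1)

/-- The Hilbert space `L²(0,1)`. -/
abbrev L2 : Type := Lp ℝ 2 μ₀₁

/-- The Hilbert space `ℝⁿ × L²(0,1)` with norm `‖(X, v)‖² = |X|² + ‖v‖²`. -/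
abbrev HSpace (n : ℕ) : Type := WithLp 2 (E n × L2)

/-- `IsH2 v f f' g`: the class `v ∈ L²(0,1)` lies in `H²(0,1)`; its `C¹` representative on `[0,1]`
is `f`, the derivative of `f` is the absolutely continuous function `f'`, and the second derivative
is `g ∈ L²(0,1)`. -/
structure IsH2 (v : L2) (f f' : ℝ → ℝ) (g : L2) : Prop where
  ae_eq : v =ᵐ[μ₀₁] f
  fst_deriv : ∀ x ∈ Icc (0 : ℝ) 1, f x = f 0 + ∫ y in (0 : ℝ)..x, f' y
  snd_deriv : ∀ x ∈ Icc (0 : ℝ) 1, f' x = f' 0 + ∫ y in (0 : ℝ)..x, g y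

/-- The action of a matrix on a Euclidean vector. -/
def act {m n : ℕ} (M : Matrix (Fin m) (Fin n) ℝ) (X : E n) : E m :=
  WithLp.toLp 2 (M.mulVec X.ofLp)

/-- The number `g X` for a row vector `g ∈ ℝ^{1×n}` and `X ∈ ℝⁿ`. -/
def rowApply {n : ℕ} (g : Matrix (Fin 1) (Fin n) ℝ) (X : E n) : ℝ := act g X 0

/-- The Euclidean norm of a row vector. -/
def rowNorm {n : ℕ} (g : Matrix (Fin 1) (Fin n) ℝ) : ℝ := ‖(WithLp.toLp 2 (g 0) : E n)‖

/-- `sat(U, ū) = sign(U) min(|U|, ū)`. -/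
def sat (U ubar : ℝ) : ℝ := Real.sign U * min |U| ubar

/-- `max_{0 ≤ x ≤ 1} F x`. -/
def maxUnit (F : ℝ → ℝ) : ℝ := sSup (F '' Icc (0 : ℝ) 1)

/-- `max_{0 ≤ y ≤ x ≤ 1} |F x y|`. -/
def maxTri (F : ℝ → ℝ → ℝ) : ℝ :=
  sSup ((fun p : ℝ × ℝ => |F p.1 p.2|) '' {p | 0 ≤ p.2 ∧ p.2 ≤ p.1 ∧ p.1 ≤ 1})

/-! ### Bessel functions -/

/-- The modified Bessel function `I₁`. -/
def besselI1 (s : ℝ) : ℝ :=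
  ∑' m : ℕ, (s / 2) ^ (2 * m + 1) / ((m.factorial : ℝ) * ((m + 1).factorial : ℝ))

/-- The Bessel function `J₁`. -/
def besselJ1 (s : ℝ) : ℝ :=
  ∑' m : ℕ, (-1) ^ m * (s / 2) ^ (2 * m + 1) / ((m.factorial : ℝ) * ((m + 1).factorial : ℝ))

/-- The entire function `v ↦ I₁(√v) / √v`, given by its power series, so that it is also defined
for `v ≤ 0`; in particular its value at `-v` is `J₁(√v) / √v`. -/
def besselRatio (v : ℝ) : ℝ :=
  (1 / 2) * ∑' m : ℕ, (v / 4) ^ m / ((m.factorial : ℝ) * ((m + 1).factorial : ℝ))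

theorem besselRatio_eq_I1 {v : ℝ} (hv : 0 < v) :
    besselRatio v = besselI1 (Real.sqrt v) / Real.sqrt v := by
  have hs : Real.sqrt v ≠ 0 := (Real.sqrt_pos.2 hv).ne'
  have h2 : (Real.sqrt v / 2) ^ 2 = v / 4 := by
    rw [div_pow, Real.sq_sqrt hv.le]; norm_num
  rw [besselRatio, besselI1, ← tsum_mul_left, ← tsum_div_const]
  refine tsum_congr fun m => ?_
  rw [pow_succ, pow_mul, h2]
  field_simp

theorem besselRatio_neg_eq_J1 {v : ℝ} (hv : 0 < v) :
    besselRatio (-v) = besselJ1 (Real.sqrt v) / Real.sqrt v := by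
  have hs : Real.sqrt v ≠ 0 := (Real.sqrt_pos.2 hv).ne'
  have h2 : (Real.sqrt v / 2) ^ 2 = v / 4 := by
    rw [div_pow, Real.sq_sqrt hv.le]; norm_num
  rw [besselRatio, besselJ1, ← tsum_mul_left, ← tsum_div_const]
  refine tsum_congr fun m => ?_
  rw [pow_succ, pow_mul, h2, neg_div, neg_pow (v / 4)]
  field_simp

/-! ### Plant, gains and backstepping kernels -/

/-- Coefficients of the plant
`X' = A X + A₁ X(t-τ) + B u(0,t)`, `u_t = u_xx + a₂ u(x,t-τ) + a u`, and the gains `K`, `c`. -/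
structure Data (n : ℕ) where
  A : Matrix (Fin n) (Fin n) ℝ
  A₁ : Matrix (Fin n) (Fin n) ℝ
  B : Matrix (Fin n) (Fin 1) ℝ
  a : ℝ
  a₂ : ℝ
  K : Matrix (Fin 1) (Fin n) ℝ
  c : ℝ

/-- `[K 0] exp([[0, M], [I, 0]] x) [I; 0]`. -/
def rowExp {n : ℕ} (K : Matrix (Fin 1) (Fin n) ℝ) (M : Matrix (Fin n) (Fin n) ℝ) (x : ℝ) :
    Matrix (Fin 1) (Fin n) ℝ :=
  (Matrix.fromCols K 0 : Matrix (Fin 1) (Fin n ⊕ Fin n) ℝ) *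
    NormedSpace.exp (x • (Matrix.fromBlocks 0 M 1 0 : Matrix (Fin n ⊕ Fin n) (Fin n ⊕ Fin n) ℝ)) *
    (Matrix.fromRows 1 0 : Matrix (Fin n ⊕ Fin n) (Fin n) ℝ)

namespace Data

variable {n : ℕ} (S : Data n)

/-- The row vector `γ(x)`. -/
def gamma (x : ℝ) : Matrix (Fin 1) (Fin n) ℝ := rowExp S.K (S.A - S.a • 1) x

/-- The row vector `ψ(x)`. -/
def psi (x : ℝ) : Matrix (Fin 1) (Fin n) ℝ := rowExp S.K (S.A + S.B * S.K - S.a • 1) x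

/-- `k(x,y) = ∫₀^{x-y} γ(σ) B dσ`. -/
def k (x y : ℝ) : ℝ := ∫ σ in (0 : ℝ)..(x - y), (S.gamma σ * S.B) 0 0

/-- `n(x,y) = ∫₀^{x-y} ψ(σ) B dσ`. -/
def nker (x y : ℝ) : ℝ := ∫ σ in (0 : ℝ)..(x - y), (S.psi σ * S.B) 0 0

/-- `q(x,y) = -(a+c) x I₁(√((a+c)(x²-y²))) / √((a+c)(x²-y²))`. -/
def q (x y : ℝ) : ℝ := -(S.a + S.c) * x * besselRatio ((S.a + S.c) * (x ^ 2 - y ^ 2))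

/-- `l(x,y) = -(a+c) x J₁(√((a+c)(x²-y²))) / √((a+c)(x²-y²))`. -/
def l (x y : ℝ) : ℝ := -(S.a + S.c) * x * besselRatio (-((S.a + S.c) * (x ^ 2 - y ^ 2)))

/-- The backstepping feedback
`U = ∫₀¹ k(1,y) u(y) dy + γ(1) X + ∫₀¹ q(1,y) [u(y) - ∫₀^y k(y,s) u(s) ds - γ(y) X] dy`. -/
def feedback (X : E n) (u : L2) : ℝ :=
  (∫ y in (0 : ℝ)..1, S.k 1 y * u y) + rowApply (S.gamma 1) X +
    ∫ y in (0 : ℝ)..1,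
      S.q 1 y * (u y - (∫ s in (0 : ℝ)..y, S.k y s * u s) - rowApply (S.gamma y) X)

/-! ### Constants -/

/-- `max |q|` over the triangle. -/
def qMax : ℝ := maxTri S.q

/-- `max |γ|` over `[0,1]`. -/
def gammaMax : ℝ := maxUnit fun x => rowNorm (S.gamma x)

/-- `ζ = (1 + max |q|)² (max |γ|)²`. -/
def zeta : ℝ := (1 + S.qMax) ^ 2 * S.gammaMax ^ 2

/-- `c₁ = |ψ(1)|`. -/
def c1 : ℝ := rowNorm (S.psi 1)

/-- `c₂ = max_y |n(1,y)| (1 + max |l|) + max_y |l(1,y)|`. -/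
def c2 : ℝ :=
  (maxUnit fun y => |S.nker 1 y|) * (1 + maxTri S.l) + maxUnit fun y => |S.l 1 y|

/-- `M₁ = 1 + 2 [max |γ| (1 + max |q|)]²`. -/
def M1 : ℝ := 1 + 2 * (S.gammaMax * (1 + S.qMax)) ^ 2

/-- `M₂ = 2 (1 + max |k|)² (1 + max |q|)²`. -/
def M2 : ℝ := 2 * (1 + maxTri S.k) ^ 2 * (1 + S.qMax) ^ 2

/-! ### The matrices of the linear matrix inequalities -/

/-- `θ₁₁ = P(A+BK) + (A+BK)ᵀP + 2δ₀P`. -/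
def theta11 (P : Matrix (Fin n) (Fin n) ℝ) (δ₀ : ℝ) : Matrix (Fin n) (Fin n) ℝ :=
  P * (S.A + S.B * S.K) + (S.A + S.B * S.K).transpose * P + (2 * δ₀) • P

/-- `Ξ = [θ₁₁, PA₁, PB; *, -2δ₁P, 0; *, *, -lam]`. -/
def Xi (P : Matrix (Fin n) (Fin n) ℝ) (lam δ₀ δ₁ : ℝ) :
    Matrix ((Fin n ⊕ Fin n) ⊕ Fin 1) ((Fin n ⊕ Fin n) ⊕ Fin 1) ℝ :=
  Matrix.fromBlocks
    (Matrix.fromBlocks (S.theta11 P δ₀) (P * S.A₁) (P * S.A₁).transpose (-(2 * δ₁) • P))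
    (Matrix.fromRows (P * S.B) 0)
    (Matrix.fromCols (P * S.B).transpose 0)
    (-lam • 1)

/-- `R = diag{0, ζ (A₁ - a₂I)ᵀ(A₁ - a₂I), 0}`. -/
def R : Matrix ((Fin n ⊕ Fin n) ⊕ Fin 1) ((Fin n ⊕ Fin n) ⊕ Fin 1) ℝ :=
  Matrix.fromBlocks
    (Matrix.fromBlocks 0 0 0
      (S.zeta • ((S.A₁ - S.a₂ • 1).transpose * (S.A₁ - S.a₂ • 1))))
    0 0 0

/-- `Θ₁ = Ξ + p₁ r⁻¹ R`. -/
def Theta1 (P : Matrix (Fin n) (Fin n) ℝ) (p₁ lam r δ₀ δ₁ : ℝ) :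
    Matrix ((Fin n ⊕ Fin n) ⊕ Fin 1) ((Fin n ⊕ Fin n) ⊕ Fin 1) ℝ :=
  S.Xi P lam δ₀ δ₁ + (p₁ * r⁻¹) • S.R

/-- `Θ₂ = [(-2c + 2δ₀ + r - π²/2) p₁ + (π²/4) lam, a₂p₁; *, -2δ₁p₁]`. -/
def Theta2 (p₁ lam r δ₀ δ₁ : ℝ) : Matrix (Fin 2) (Fin 2) ℝ :=
  !![(-2 * S.c + 2 * δ₀ + r - Real.pi ^ 2 / 2) * p₁ + Real.pi ^ 2 / 4 * lam, S.a₂ * p₁;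
     S.a₂ * p₁, -2 * δ₁ * p₁]

/-! ### Initial data and solutions -/

/-- The space `W₁ = C([-h,0], D(𝒜_u)) ∩ C¹([-h,0], ℝⁿ × L²(0,1))` of initial functions, where
`D(𝒜_u)` consists of the `(X,u) ∈ ℝⁿ × H²(0,1)` with `u'(0) = 0` and `u(1)` equal to the unsaturated
feedback of `(X,u)`. Continuity in `H²(0,1)` is continuity of `u` and `u''` in `L²(0,1)`. -/
def W1 (h : ℝ) : Set ((ℝ → E n) × (ℝ → L2)) :=
  {p | ContDiffOn ℝ 1 p.1 (Icc (-h) 0) ∧ ContDiffOn ℝ 1 p.2 (Icc (-h) 0) ∧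
    ∃ g : ℝ → L2, ContinuousOn g (Icc (-h) 0) ∧ ∀ θ ∈ Icc (-h) 0,
      ∃ f f' : ℝ → ℝ, IsH2 (p.2 θ) f f' (g θ) ∧ f' 0 = 0 ∧ f 1 = S.feedback (p.1 θ) (p.2 θ)}

/-- The set
`𝒳_u = {(X₀,u₀) ∈ W₁ : M₁ max_{[-h,0]} |X₀|² + M₂ max_{[-h,0]} ‖u₀‖² ≤ β⁻¹}`. -/
def Xu (h β : ℝ) : Set ((ℝ → E n) × (ℝ → L2)) :=
  {p | p ∈ S.W1 h ∧
    S.M1 * sSup ((fun θ => ‖p.1 θ‖ ^ 2) '' Icc (-h) 0) +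
      S.M2 * sSup ((fun θ => ‖p.2 θ‖ ^ 2) '' Icc (-h) 0) ≤ β⁻¹}

/-- `(X, u)`, defined for `t ≥ -h`, is a classical solution of
`X' = A X + A₁ X(t-τ(t)) + B u(0,t)`, `u_t = u_xx + a₂ u(x,t-τ(t)) + a u`, `u_x(0,t) = 0`,
`u(1,t) = sat(U(t), ū)`, with initial functions `(X₀, u₀)` on `[-h,0]`: it is of class `C¹` on
`[0,∞)` with values in `ℝⁿ × L²(0,1)`, `u(·,t) ∈ H²(0,1)`, and the equations hold for all `t ≥ 0`
(with the one-sided time derivative at `t = 0`). -/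
structure IsClassicalSolution (ubar h : ℝ) (τ : ℝ → ℝ) (X₀ : ℝ → E n) (u₀ : ℝ → L2)
    (X : ℝ → E n) (u : ℝ → L2) : Prop where
  init : ∀ θ ∈ Icc (-h) 0, X θ = X₀ θ ∧ u θ = u₀ θ
  contDiff_X : ContDiffOn ℝ 1 X (Ici 0)
  contDiff_u : ContDiffOn ℝ 1 u (Ici 0)
  equations : ∀ t : ℝ, 0 ≤ t → ∃ (f f' : ℝ → ℝ) (g : L2),
    IsH2 (u t) f f' g ∧ f' 0 = 0 ∧
    (0 < t → f 1 = sat (S.feedback (X t) (u t)) ubar) ∧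
    HasDerivWithinAt X
      (act S.A (X t) + act S.A₁ (X (t - τ t)) + act S.B (WithLp.toLp 2 fun _ => f 0))
      (Ici 0) t ∧
    HasDerivWithinAt u (g + S.a₂ • u (t - τ t) + S.a • u t) (Ici 0) t

end Data

end

end HeatODE

namespace HeatODE

noncomputable section

/-! ### Volterra operators on `L²(0,1)` -/

/-! Two backstepping transformations turn the unsaturated loop into a stable one. With `w = u - k *
u - γX` and `z = w - ∫₀ˣ q w`, the feedback `u(1) = U` becomes `z(1) = 0`, and the new variables
satisfy `X' = (A+BK)X + A₁X(t-τ) + Bz(0)` and `z_t = z_xx - cz + a₂z(t-τ) - D`. Here `D` is the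
transform of `γ(A₁ - a₂I)X(t-τ)`, left over because the two delay terms do not match.

For `V = XᵀPX + p₁‖z‖²` the matrix inequalities yield `V' + 2δV - 2δV(t-τ) ≤ -ε(|X|² + ‖z‖²)`
(`exists_dissipation`), through Wirtinger's inequality, `z(0)² ≤ ‖z'‖²` and Young's inequality for
`D`. The margin `ε` exists because the inequalities are strict, and it is what gives decay although
both rates equal `δ`.

The bounds with `c₁, c₂` make `|U| ≤ ū` wherever `V ≤ 1`, and `𝒳_u` forces `V ≤ 1` on the initial
interval. Comparison of `V` with `e^{-αt}` by a first-crossing argument (`le_of_crossing`) gives the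
decay and inactivity of the saturation at once: at a touching time the past lies below the
exponential, so the boundary condition is linear there and `V(t-τ) ≤ e^{αh} e^{-αt}`; for small `α`
this makes `V'` smaller than the slope of the exponential. Since `(X,u) ↦ (X,z)` is boundedly
invertible, `V → 0` gives the claim.

The kernel identities are proved without differentiating kernels. An `H²` function with zero slope
at `0` is written as `f₀ • one + dint g`, so that second derivatives become statements about bounded
operators on `L²`. Convolutions commute with `dint`. The Bessel transformation is handled through
its action on the solutions `phi μ` of `φ'' = μφ`, `φ(0) = 1`, `φ'(0) = 0`: it sends `phi μ` to `phi
(μ + κ)` (`besselT_phi`). These functions span a dense subspace, so inversion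
(`besselT_neg_besselT`) and intertwining with `dint` (`besselT_dint`) follow. The operators `k` and
`n` are related by Duhamel's formula (`rowVec_resolvent`). -/

instance isProbabilityMeasure_unit : IsProbabilityMeasure μ₀₁ := ⟨by simp⟩

theorem integrable_coe (w : L2) : Integrable w μ₀₁ :=
  (Lp.memLp w).integrable (by norm_num)

theorem intervalIntegrable_of_unit {f : ℝ → ℝ} (hf : Integrable f μ₀₁) {x y : ℝ}
    (hx : x ∈ Icc (0 : ℝ) 1) (hy : y ∈ Icc (0 : ℝ) 1) : IntervalIntegrable f volume x y := by
  have h1 : IntervalIntegrable f volume 0 1 := by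
    rw [intervalIntegrable_iff_integrableOn_Ioo_of_le zero_le_one]; exact hf
  refine h1.mono_set ?_
  rw [uIcc_of_le zero_le_one]
  exact uIcc_subset_Icc hx hy

theorem ae_restrict_of_ae_unit {p : ℝ → Prop} (h : ∀ᵐ y ∂μ₀₁, p y) {x : ℝ}
    (hx : x ∈ Icc (0 : ℝ) 1) : ∀ᵐ y ∂volume.restrict (Ioc 0 x), p y := by
  have : ∀ᵐ y ∂volume.restrict (Ioc (0 : ℝ) 1), p y := by
    rwa [← restrict_Ioo_eq_restrict_Ioc]
  exact ae_restrict_of_ae_restrict_of_subset (Ioc_subset_Ioc_right hx.2) this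

theorem integral_congr_unit {f g : ℝ → ℝ} (h : f =ᵐ[μ₀₁] g) {x : ℝ} (hx : x ∈ Icc (0 : ℝ) 1) :
    ∫ y in (0 : ℝ)..x, f y = ∫ y in (0 : ℝ)..x, g y := by
  rw [intervalIntegral.integral_of_le hx.1, intervalIntegral.integral_of_le hx.1]
  exact integral_congr_ae (ae_restrict_of_ae_unit h hx)

theorem integral_unit (f : ℝ → ℝ) : ∫ y, f y ∂μ₀₁ = ∫ y in (0 : ℝ)..1, f y := by
  rw [intervalIntegral.integral_of_le zero_le_one, integral_Ioc_eq_integral_Ioo]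

/-- Continuous functions that agree almost everywhere on `(0,1)` agree on `[0,1]`. -/
theorem eqOn_of_ae_unit {f g : ℝ → ℝ} (h : f =ᵐ[μ₀₁] g) (hf : ContinuousOn f (Icc 0 1))
    (hg : ContinuousOn g (Icc 0 1)) : EqOn f g (Icc 0 1) := by
  have h' : f =ᵐ[volume.restrict (Icc (0 : ℝ) 1)] g := by
    rwa [← restrict_Ioo_eq_restrict_Icc]
  refine Measure.eqOn_of_ae_eq h' hf hg ?_
  rw [interior_Icc, closure_Ioo zero_ne_one]

theorem memLp_unit {f : ℝ → ℝ} (hf : ContinuousOn f (Icc 0 1)) : MemLp f 2 μ₀₁ := by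
  obtain ⟨C, hC⟩ := isCompact_Icc.exists_bound_of_continuousOn hf
  refine MemLp.of_bound ((hf.mono Ioo_subset_Icc_self).aestronglyMeasurable measurableSet_Ioo) C ?_
  exact (ae_restrict_mem measurableSet_Ioo).mono fun x hx => hC x (Ioo_subset_Icc_self hx)

/-- The class of a function in `L²(0,1)`. -/
def cls (f : ℝ → ℝ) : L2 := by
  -- The value `0` outside `L²` is a default; the lemmas below concern functions continuous on
  -- `[0,1]`, where it does not occur.
  classical exact if h : MemLp f 2 μ₀₁ then h.toLp f else 0

theorem cls_ae {f : ℝ → ℝ} (hf : ContinuousOn f (Icc 0 1)) : cls f =ᵐ[μ₀₁] f := by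
  rw [cls, dif_pos (memLp_unit hf)]
  exact MemLp.coeFn_toLp _

theorem cls_eq_iff {f : ℝ → ℝ} (hf : ContinuousOn f (Icc 0 1)) {w : L2} :
    cls f = w ↔ f =ᵐ[μ₀₁] w :=
  ⟨fun h => (cls_ae hf).symm.trans (by rw [h]), fun h => Lp.ext ((cls_ae hf).trans h)⟩

theorem integral_abs_le_norm (w : L2) : ∫ y, |w y| ∂μ₀₁ ≤ ‖w‖ := by
  have h1 : eLpNorm w 1 μ₀₁ ≤ eLpNorm w 2 μ₀₁ :=
    eLpNorm_le_eLpNorm_of_exponent_le (by norm_num) (Lp.aestronglyMeasurable w)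
  have h2 := ENNReal.toReal_mono (Lp.eLpNorm_ne_top w) h1
  rw [Lp.norm_def]
  refine le_trans (le_of_eq ?_) h2
  rw [eLpNorm_one_eq_lintegral_enorm, ← integral_norm_eq_lintegral_enorm (Lp.aestronglyMeasurable w)]
  rfl

/-- The interval has total mass one, so the `L¹` norm is at most the `L²` norm. Hence operator norms
are controlled by the maxima of the kernels, the form in which the constants of the theorem are
stated. -/
theorem abs_integral_mul_le {F : ℝ → ℝ} {M : ℝ} (w : L2) {x : ℝ} (hx : x ∈ Icc (0 : ℝ) 1)
    (hF : ∀ y ∈ Icc 0 x, |F y| ≤ M) :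
    |∫ y in (0 : ℝ)..x, F y * w y| ≤ M * ‖w‖ := by
  have hM : 0 ≤ M := (abs_nonneg _).trans (hF 0 ⟨le_rfl, hx.1⟩)
  have hi := (intervalIntegrable_of_unit (integrable_coe w) ⟨le_rfl, zero_le_one⟩ hx).abs.const_mul M
  have hi1 := (intervalIntegrable_of_unit (integrable_coe w) ⟨le_rfl, zero_le_one⟩
    ⟨zero_le_one, le_rfl⟩).abs
  calc |∫ y in (0 : ℝ)..x, F y * w y| ≤ ∫ y in (0 : ℝ)..x, M * |w y| := by
        rw [← Real.norm_eq_abs]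
        refine intervalIntegral.norm_integral_le_of_norm_le hx.1 (Eventually.of_forall ?_) hi
        intro y hy
        rw [Real.norm_eq_abs, abs_mul]
        exact mul_le_mul_of_nonneg_right (hF y ⟨hy.1.le, hy.2⟩) (abs_nonneg _)
    _ = M * ∫ y in (0 : ℝ)..x, |w y| := intervalIntegral.integral_const_mul _ _
    _ ≤ M * ∫ y in (0 : ℝ)..1, |w y| := by
        refine mul_le_mul_of_nonneg_left ?_ hM
        exact intervalIntegral.integral_mono_interval le_rfl hx.1 hx.2
          (Eventually.of_forall fun y => abs_nonneg _) hi1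
    _ ≤ M * ‖w‖ := by
        rw [← integral_unit]
        exact mul_le_mul_of_nonneg_left (integral_abs_le_norm w) hM

/-- `∫₀ˣ F(x,y) w(y) dy`. -/
def voltFun (F : ℝ → ℝ → ℝ) (w : ℝ → ℝ) (x : ℝ) : ℝ := ∫ y in (0 : ℝ)..x, F x y * w y

theorem voltFun_congr {F : ℝ → ℝ → ℝ} {w w' : ℝ → ℝ} (h : w =ᵐ[μ₀₁] w') {x : ℝ}
    (hx : x ∈ Icc (0 : ℝ) 1) : voltFun F w x = voltFun F w' x :=
  integral_congr_unit (h.mono fun y hy => by simp only [hy]) hx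

theorem intervalIntegrable_kernel_mul {F : ℝ → ℝ} (hF : Continuous F) {w : ℝ → ℝ}
    (hw : Integrable w μ₀₁) {x : ℝ} (hx : x ∈ Icc (0 : ℝ) 1) :
    IntervalIntegrable (fun y => F y * w y) volume 0 x :=
  (intervalIntegrable_of_unit hw ⟨le_rfl, zero_le_one⟩ hx).continuousOn_mul hF.continuousOn

/-- Dominated convergence. Cutting `w` off outside `(0,1)` makes it integrable on the line, so that
the upper limit may vary in a full neighbourhood of each `x₀`, endpoints included. -/
theorem voltFun_continuousOn {F : ℝ → ℝ → ℝ} (hF : Continuous fun p : ℝ × ℝ => F p.1 p.2)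
    {w : ℝ → ℝ} (hw : Integrable w μ₀₁) : ContinuousOn (voltFun F w) (Icc 0 1) := by
  let w' : ℝ → ℝ := (Ioo (0 : ℝ) 1).indicator w
  have hw' : Integrable w' volume := (integrable_indicator_iff measurableSet_Ioo).2 hw
  have hww : w =ᵐ[μ₀₁] w' :=
    (ae_restrict_mem measurableSet_Ioo).mono fun y hy => (indicator_of_mem hy w).symm
  have key : ContinuousOn (voltFun F w') (Icc 0 1) := by
    intro x₀ hx₀
    refine ContinuousAt.continuousWithinAt ?_
    -- Any box containing `[0,1]²` in its interior serves here.
    obtain ⟨C, hC⟩ := (((isCompact_Icc (a := (-1 : ℝ)) (b := 2)).prod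
      (isCompact_Icc (a := (-1 : ℝ)) (b := 2))).exists_bound_of_continuousOn hF.continuousOn)
    have := intervalIntegral.continuousAt_parametric_primitive_of_dominated
      (F := fun x y => F x y * w' y) (μ := volume) (a₀ := 0) (b₀ := x₀)
      (fun y => C * |w' y|) (-1) 2 (x₀ := x₀)
      (fun x => ((hF.comp (by fun_prop : Continuous fun y => (x, y))).aestronglyMeasurable.mul
        hw'.aestronglyMeasurable.restrict))
      ?_ ((hw'.abs.const_mul C).intervalIntegrable) ?_ ⟨by norm_num, by norm_num⟩
      ⟨by linarith [hx₀.1], by linarith [hx₀.2]⟩ (measure_singleton _)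
    · exact this.comp (f := fun x => (x, x)) (by fun_prop)
    · have : Icc (-1 : ℝ) 2 ∈ 𝓝 x₀ := Icc_mem_nhds (by linarith [hx₀.1]) (by linarith [hx₀.2])
      filter_upwards [this] with x hx
      rw [uIoc_of_le (by norm_num)]
      refine (ae_restrict_mem measurableSet_Ioc).mono fun y hy => ?_
      rw [norm_mul]
      exact mul_le_mul_of_nonneg_right (hC (x, y) ⟨hx, Ioc_subset_Icc_self hy⟩) (abs_nonneg _)
    · refine Eventually.of_forall fun y => ?_
      exact ((hF.comp (by fun_prop : Continuous fun x => (x, y))).continuousAt).mul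
        continuousAt_const
  exact key.congr fun x hx => voltFun_congr hww hx

theorem exists_kernel_bound {F : ℝ → ℝ → ℝ} (hF : Continuous fun p : ℝ × ℝ => F p.1 p.2) :
    ∃ C, 0 ≤ C ∧ ∀ x ∈ Icc (0 : ℝ) 1, ∀ y ∈ Icc (0 : ℝ) x, |F x y| ≤ C := by
  obtain ⟨C, hC⟩ := (((isCompact_Icc (a := (0 : ℝ)) (b := 1)).prod
      (isCompact_Icc (a := (0 : ℝ)) (b := 1))).exists_bound_of_continuousOn hF.continuousOn)
  refine ⟨|C|, abs_nonneg _, fun x hx y hy => ?_⟩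
  exact (hC (x, y) ⟨hx, hy.1, hy.2.trans hx.2⟩).trans (le_abs_self _)

theorem norm_le_of_ae_bound {w : L2} {C : ℝ} (hC : 0 ≤ C) (h : ∀ᵐ x ∂μ₀₁, |w x| ≤ C) :
    ‖w‖ ≤ C := by
  refine (Lp.norm_le_of_ae_bound hC h).trans (le_of_eq ?_)
  simp [measureUnivNNReal]

theorem norm_cls_le {f : ℝ → ℝ} (hf : ContinuousOn f (Icc 0 1)) {C : ℝ} (hC : 0 ≤ C)
    (h : ∀ x ∈ Icc (0 : ℝ) 1, |f x| ≤ C) : ‖cls f‖ ≤ C := by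
  refine norm_le_of_ae_bound hC ?_
  filter_upwards [cls_ae hf, ae_restrict_mem measurableSet_Ioo] with x hx hx'
  rw [hx]
  exact h x (Ioo_subset_Icc_self hx')

/-- The Volterra operator `w ↦ ∫₀ˣ F(x,y) w(y) dy` on `L²(0,1)`. -/
def volt (F : ℝ → ℝ → ℝ) (hF : Continuous fun p : ℝ × ℝ => F p.1 p.2) : L2 →L[ℝ] L2 :=
  LinearMap.mkContinuous
    { toFun := fun w => cls (voltFun F w)
      map_add' := by
        intro v w
        rw [cls_eq_iff (voltFun_continuousOn hF (integrable_coe _))]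
        filter_upwards [Lp.coeFn_add (cls (voltFun F v)) (cls (voltFun F w)),
          cls_ae (voltFun_continuousOn hF (integrable_coe v)),
          cls_ae (voltFun_continuousOn hF (integrable_coe w)),
          ae_restrict_mem measurableSet_Ioo] with x h1 h2 h3 h4
        have hx := Ioo_subset_Icc_self h4
        have hc : ∀ x, Continuous (F x) := fun x => hF.comp (by fun_prop : Continuous fun y => (x, y))
        rw [h1, Pi.add_apply, h2, h3, voltFun_congr (Lp.coeFn_add v w) hx]
        simp only [voltFun, Pi.add_apply, mul_add]
        exact intervalIntegral.integral_add
          (intervalIntegrable_kernel_mul (hc x) (integrable_coe v) hx)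
          (intervalIntegrable_kernel_mul (hc x) (integrable_coe w) hx)
      map_smul' := by
        intro r w
        rw [cls_eq_iff (voltFun_continuousOn hF (integrable_coe _))]
        filter_upwards [Lp.coeFn_smul r (cls (voltFun F w)),
          cls_ae (voltFun_continuousOn hF (integrable_coe w)),
          ae_restrict_mem measurableSet_Ioo] with x h1 h3 h4
        have hx := Ioo_subset_Icc_self h4
        simp only [RingHom.id_apply]
        rw [h1, Pi.smul_apply, h3, voltFun_congr (Lp.coeFn_smul r w) hx]
        simp only [voltFun, Pi.smul_apply, smul_eq_mul, mul_left_comm _ r]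
        exact intervalIntegral.integral_const_mul _ _ }
    (exists_kernel_bound hF).choose (by
      intro w
      obtain ⟨h0, h⟩ := (exists_kernel_bound hF).choose_spec
      refine norm_cls_le (voltFun_continuousOn hF (integrable_coe _)) (by positivity) ?_
      intro x hx
      exact abs_integral_mul_le w hx (h x hx))

section

variable {F : ℝ → ℝ → ℝ} (hF : Continuous fun p : ℝ × ℝ => F p.1 p.2)

theorem volt_ae (w : L2) : volt F hF w =ᵐ[μ₀₁] voltFun F w :=
  cls_ae (voltFun_continuousOn hF (integrable_coe w))

theorem volt_cls {f : ℝ → ℝ} (hf : ContinuousOn f (Icc 0 1)) {g : ℝ → ℝ}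
    (hg : ContinuousOn g (Icc 0 1)) (h : ∀ x ∈ Icc (0 : ℝ) 1, voltFun F f x = g x) :
    volt F hF (cls f) = cls g := by
  refine Lp.ext ?_
  filter_upwards [volt_ae hF (cls f), cls_ae hg, ae_restrict_mem measurableSet_Ioo] with x h1 h2 h3
  have hx := Ioo_subset_Icc_self h3
  rw [h1, h2, voltFun_congr (cls_ae hf) hx, h x hx]

theorem norm_volt_le {M : ℝ} (hM : ∀ x ∈ Icc (0 : ℝ) 1, ∀ y ∈ Icc (0 : ℝ) x, |F x y| ≤ M) (w : L2) :
    ‖volt F hF w‖ ≤ M * ‖w‖ := by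
  have h0 : 0 ≤ M := (abs_nonneg _).trans (hM 0 ⟨le_rfl, zero_le_one⟩ 0 ⟨le_rfl, le_rfl⟩)
  exact norm_cls_le (voltFun_continuousOn hF (integrable_coe _)) (by positivity)
    fun x hx => abs_integral_mul_le w hx (hM x hx)

end

/-! ### Composition of Volterra operators -/

/-- The kernel of the composition of two Volterra operators. -/
def kcomp (F G : ℝ → ℝ → ℝ) (x y : ℝ) : ℝ := ∫ s in y..x, F x s * G s y

/-- Fubini on the triangle `0 < y < s ≤ x`; the indicator in `Φ` encodes the triangle inside the
square. -/
theorem voltFun_voltFun {F G : ℝ → ℝ → ℝ} (hF : Continuous fun p : ℝ × ℝ => F p.1 p.2)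
    (hG : Continuous fun p : ℝ × ℝ => G p.1 p.2) {w : ℝ → ℝ} (hw : Integrable w μ₀₁) {x : ℝ}
    (hx : x ∈ Icc (0 : ℝ) 1) : voltFun F (voltFun G w) x = voltFun (kcomp F G) w x := by
  let ν : Measure ℝ := volume.restrict (Ioc 0 x)
  have hwν : Integrable w ν := (intervalIntegrable_of_unit hw ⟨le_rfl, zero_le_one⟩ hx).1
  let Φ : ℝ × ℝ → ℝ := {p : ℝ × ℝ | p.2 < p.1}.indicator fun p => F x p.1 * G p.1 p.2
  have hΦm : Measurable Φ := by
    refine Measurable.indicator ?_ (measurableSet_lt measurable_snd measurable_fst)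
    exact ((hF.comp (by fun_prop : Continuous fun p : ℝ × ℝ => (x, p.1))).mul hG).measurable
  obtain ⟨C, hC0, hC⟩ := exists_kernel_bound hF
  obtain ⟨D, hD0, hD⟩ := exists_kernel_bound hG
  have hint : Integrable (fun p : ℝ × ℝ => Φ p * w p.2) (ν.prod ν) := by
    refine Integrable.bdd_mul (c := C * D) (Integrable.comp_snd hwν ν) hΦm.aestronglyMeasurable ?_
    have h1 : ∀ᵐ p ∂(ν.prod ν), p ∈ Ioc 0 x ×ˢ Ioc 0 x := by
      rw [show ν.prod ν = _ from Measure.prod_restrict _ _]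
      exact ae_restrict_mem (measurableSet_Ioc.prod measurableSet_Ioc)
    filter_upwards [h1] with p hp
    simp only [Φ]
    by_cases hlt : p.2 < p.1
    · rw [indicator_of_mem (show p ∈ {p : ℝ × ℝ | p.2 < p.1} from hlt), norm_mul]
      refine mul_le_mul (hC x hx _ ⟨hp.1.1.le, hp.1.2⟩)
        (hD _ ⟨hp.1.1.le, hp.1.2.trans hx.2⟩ _ ⟨hp.2.1.le, hlt.le⟩) (norm_nonneg _) hC0
    · rw [indicator_of_notMem (show p ∉ {p : ℝ × ℝ | p.2 < p.1} from hlt), norm_zero]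
      positivity
  have hswap := integral_integral_swap (f := fun s y => Φ (s, y) * w y) (μ := ν) (ν := ν) hint
  have hL : voltFun F (voltFun G w) x = ∫ s, ∫ y, Φ (s, y) * w y ∂ν ∂ν := by
    rw [voltFun, intervalIntegral.integral_of_le hx.1]
    refine setIntegral_congr_fun measurableSet_Ioc fun s hs => ?_
    have : (fun y => Φ (s, y) * w y) = (Iio s).indicator fun y => F x s * (G s y * w y) := by
      funext y
      by_cases h : y < s
      · simp [Φ, indicator, h, mul_assoc]
      · simp [Φ, indicator, h]
    rw [this, setIntegral_indicator measurableSet_Iio, integral_const_mul, voltFun,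
      intervalIntegral.integral_of_le hs.1.le, integral_Ioc_eq_integral_Ioo]
    congr 3
    ext y
    simp only [mem_Ioo, mem_inter_iff, mem_Ioc, mem_Iio]
    constructor
    · rintro ⟨h1, h2⟩; exact ⟨⟨h1, h2.le.trans hs.2⟩, h2⟩
    · rintro ⟨⟨h1, _⟩, h2⟩; exact ⟨h1, h2⟩
  have hR : voltFun (kcomp F G) w x = ∫ y, ∫ s, Φ (s, y) * w y ∂ν ∂ν := by
    rw [voltFun, intervalIntegral.integral_of_le hx.1]
    refine setIntegral_congr_fun measurableSet_Ioc fun y hy => ?_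
    have : (fun s => Φ (s, y) * w y) = (Ioi y).indicator fun s => (F x s * G s y) * w y := by
      funext s
      by_cases h : y < s
      · simp [Φ, indicator, h]
      · simp [Φ, indicator, h]
    rw [this, setIntegral_indicator measurableSet_Ioi, integral_mul_const, kcomp,
      intervalIntegral.integral_of_le hy.2]
    congr 3
    ext s
    simp only [mem_inter_iff, mem_Ioc, mem_Ioi]
    constructor
    · rintro ⟨h1, h2⟩; exact ⟨⟨hy.1.trans h1, h2⟩, h1⟩
    · rintro ⟨⟨_, h1⟩, h2⟩; exact ⟨h2, h1⟩
  rw [hL, hR, hswap]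

theorem volt_volt {F G H : ℝ → ℝ → ℝ} (hF : Continuous fun p : ℝ × ℝ => F p.1 p.2)
    (hG : Continuous fun p : ℝ × ℝ => G p.1 p.2) (hH : Continuous fun p : ℝ × ℝ => H p.1 p.2)
    (h : ∀ x y, kcomp F G x y = H x y) (w : L2) :
    volt F hF (volt G hG w) = volt H hH w := by
  refine Lp.ext ?_
  filter_upwards [volt_ae hF (volt G hG w), volt_ae hH w, ae_restrict_mem measurableSet_Ioo]
    with x h1 h2 h3
  have hx := Ioo_subset_Icc_self h3
  rw [h1, h2, voltFun_congr (volt_ae hG w) hx, voltFun_voltFun hF hG (integrable_coe w) hx,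
    show kcomp F G = H from funext fun x => funext fun y => h x y]

/-! ### Convolution operators. -/

/-- The convolution `∫₀ˣ a(x-y) b(y) dy`. -/
def cconv (a b : ℝ → ℝ) (x : ℝ) : ℝ := ∫ y in (0 : ℝ)..x, a (x - y) * b y

theorem cconv_comm (a b : ℝ → ℝ) : cconv a b = cconv b a := by
  funext x
  have := intervalIntegral.integral_comp_sub_left (fun y => a y * b (x - y)) x (a := 0) (b := x)
  simp only [sub_sub_cancel, sub_self, sub_zero] at this
  rw [cconv, cconv, this]
  exact intervalIntegral.integral_congr fun y _ => mul_comm _ _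

theorem kcomp_conv (a b : ℝ → ℝ) (x y : ℝ) :
    kcomp (fun x y => a (x - y)) (fun x y => b (x - y)) x y = cconv a b (x - y) := by
  have := intervalIntegral.integral_comp_sub_right (fun s => a (x - y - s) * b s) y (a := y) (b := x)
  rw [sub_self] at this
  rw [kcomp, cconv, ← this]
  exact intervalIntegral.integral_congr fun s _ => by ring_nf

theorem continuous_conv_kernel {a : ℝ → ℝ} (ha : Continuous a) :
    Continuous fun p : ℝ × ℝ => a (p.1 - p.2) := by fun_prop

theorem continuous_cconv {a b : ℝ → ℝ} (ha : Continuous a) (hb : Continuous b) :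
    Continuous (cconv a b) := by
  have h : Continuous fun p : ℝ × ℝ => a (p.1 - p.2) * b p.2 := by fun_prop
  exact intervalIntegral.continuous_parametric_intervalIntegral_of_continuous (μ := volume)
    (f := fun x y => a (x - y) * b y) h continuous_id

/-- Convolution by a continuous function on `L²(0,1)`. -/
def conv (a : ℝ → ℝ) (ha : Continuous a) : L2 →L[ℝ] L2 :=
  volt (fun x y => a (x - y)) (continuous_conv_kernel ha)

theorem conv_conv {a b : ℝ → ℝ} (ha : Continuous a) (hb : Continuous b) (w : L2) :
    conv a ha (conv b hb w) = conv (cconv a b) (continuous_cconv ha hb) w :=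
  volt_volt _ _ _ (kcomp_conv a b) w

theorem conv_congr {a b : ℝ → ℝ} (h : a = b) (ha : Continuous a) (hb : Continuous b) (w : L2) :
    conv a ha w = conv b hb w := by subst h; rfl

theorem conv_comm {a b : ℝ → ℝ} (ha : Continuous a) (hb : Continuous b) (w : L2) :
    conv a ha (conv b hb w) = conv b hb (conv a ha w) := by
  rw [conv_conv, conv_conv]
  exact conv_congr (cconv_comm a b) _ _ w

theorem conv_cls {a b : ℝ → ℝ} (ha : Continuous a) (hb : Continuous b) :
    conv a ha (cls b) = cls (cconv a b) :=
  volt_cls _ hb.continuousOn (continuous_cconv ha hb).continuousOn fun _ _ => rfl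

theorem conv_ae {a : ℝ → ℝ} (ha : Continuous a) (w : L2) :
    conv a ha w =ᵐ[μ₀₁] fun x => ∫ y in (0 : ℝ)..x, a (x - y) * w y :=
  volt_ae _ w

theorem conv_add_kernel {a b d : ℝ → ℝ} (ha : Continuous a) (hb : Continuous b) (hd : Continuous d)
    (h : ∀ x, d x = a x + b x) (w : L2) : conv d hd w = conv a ha w + conv b hb w := by
  refine Lp.ext ?_
  filter_upwards [Lp.coeFn_add (conv a ha w) (conv b hb w), conv_ae ha w, conv_ae hb w, conv_ae hd w,
    ae_restrict_mem measurableSet_Ioo] with x h1 h2 h3 h4 h5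
  have hx := Ioo_subset_Icc_self h5
  rw [h1, Pi.add_apply, h2, h3, h4, ← intervalIntegral.integral_add
    (intervalIntegrable_kernel_mul (by fun_prop) (integrable_coe w) hx)
    (intervalIntegrable_kernel_mul (by fun_prop) (integrable_coe w) hx)]
  simp only [h, add_mul]

/-! ### Double integration and `H²` functions. -/

/-- Double integration from `0`, i.e. `g ↦ ∫₀ˣ (x-y) g(y) dy`. -/
def dint : L2 →L[ℝ] L2 := conv (fun x => x) continuous_id

theorem cconv_one_one : cconv (fun _ => 1) (fun _ => 1) = fun x => x := by
  funext x; simp [cconv]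

theorem dint_eq (w : L2) :
    dint w = conv (fun _ => 1) continuous_const (conv (fun _ => 1) continuous_const w) := by
  rw [conv_conv]
  exact conv_congr cconv_one_one.symm _ _ w

theorem integral_integral_eq {g : ℝ → ℝ} (hg : Integrable g μ₀₁) {x : ℝ}
    (hx : x ∈ Icc (0 : ℝ) 1) :
    ∫ y in (0 : ℝ)..x, ∫ s in (0 : ℝ)..y, g s = ∫ y in (0 : ℝ)..x, (x - y) * g y := by
  have h := voltFun_voltFun (F := fun _ _ => 1) (G := fun _ _ => 1) (by fun_prop) (by fun_prop) hg hx
  simpa [voltFun, kcomp] using h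

/-- A function with vanishing derivative at `0` is recovered from its second derivative. -/
theorem IsH2.eq_dint {v : L2} {f f' : ℝ → ℝ} {g : L2} (h : IsH2 v f f' g) (h0 : f' 0 = 0)
    {x : ℝ} (hx : x ∈ Icc (0 : ℝ) 1) : f x = f 0 + ∫ y in (0 : ℝ)..x, (x - y) * g y := by
  rw [h.fst_deriv x hx, ← integral_integral_eq (integrable_coe g) hx]
  congr 1
  refine intervalIntegral.integral_congr fun y hy => ?_
  rw [uIcc_of_le hx.1] at hy
  rw [h.snd_deriv y ⟨hy.1, hy.2.trans hx.2⟩, h0, zero_add]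

theorem continuousOn_dint (g : L2) :
    ContinuousOn (fun x => ∫ y in (0 : ℝ)..x, (x - y) * g y) (Icc 0 1) :=
  voltFun_continuousOn (F := fun x y => x - y) (by fun_prop) (integrable_coe g)

/-- The class of the constant function `1`. -/
def one : L2 := cls fun _ => 1

theorem affine_dint_ae (z₀ : ℝ) (g : L2) :
    (z₀ • one + dint g : L2) =ᵐ[μ₀₁] fun x => z₀ + ∫ y in (0 : ℝ)..x, (x - y) * g y := by
  filter_upwards [Lp.coeFn_add (z₀ • one) (dint g), Lp.coeFn_smul z₀ one,
    cls_ae (f := fun _ => (1 : ℝ)) continuousOn_const,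
    conv_ae (a := fun x => x) continuous_id g] with x h1 h2 h3 h4
  rw [h1, Pi.add_apply, h2, Pi.smul_apply, one, h3, dint, h4]
  simp

/-- This representation lets second derivatives be treated by bounded operators: `g` is the second
derivative and `f 0` the boundary value. -/
theorem IsH2.class_eq {v : L2} {f f' : ℝ → ℝ} {g : L2} (h : IsH2 v f f' g) (h0 : f' 0 = 0) :
    v = f 0 • one + dint g := by
  refine Lp.ext ?_
  filter_upwards [h.ae_eq, affine_dint_ae (f 0) g, ae_restrict_mem measurableSet_Ioo] with x h1 h2 h3
  rw [h1, h2, h.eq_dint h0 (Ioo_subset_Icc_self h3)]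

theorem IsH2.continuousOn {v : L2} {f f' : ℝ → ℝ} {g : L2} (h : IsH2 v f f' g) (h0 : f' 0 = 0) :
    ContinuousOn f (Icc 0 1) :=
  (continuousOn_const.add (continuousOn_dint g)).congr fun _ hx => h.eq_dint h0 hx

theorem hasDerivAt_integral_of_continuous {f : ℝ → ℝ} (hf : Continuous f) (x : ℝ) :
    HasDerivAt (fun x => ∫ y in (0 : ℝ)..x, f y) (f x) x :=
  intervalIntegral.integral_hasDerivAt_right (hf.intervalIntegrable _ _)
    hf.stronglyMeasurable.stronglyMeasurableAtFilter hf.continuousAt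

/-- Taylor's formula of order two with vanishing first derivative. -/
theorem eq_add_cconv_of_hasDerivAt {f f' g : ℝ → ℝ} (hf : ∀ x, HasDerivAt f (f' x) x)
    (hf' : ∀ x, HasDerivAt f' (g x) x) (hg : Continuous g) (h0 : f' 0 = 0) (x : ℝ) :
    f x = f 0 + cconv (fun x => x) g x := by
  have hc : Continuous f' := continuous_iff_continuousAt.2 fun x => (hf' x).continuousAt
  have h := intervalIntegral.integral_mul_deriv_eq_deriv_mul (a := 0) (b := x)
    (u := fun y => x - y) (v := f') (u' := fun _ => -1) (v' := g)
    (fun y _ => by simpa using (hasDerivAt_id y).const_sub x) (fun y _ => hf' y)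
    (by simp) (hg.intervalIntegrable _ _)
  have h2 := intervalIntegral.integral_eq_sub_of_hasDerivAt (a := 0) (b := x)
    (fun y _ => hf y) (hc.intervalIntegrable _ _)
  simp only [cconv, h, h0, sub_self, zero_mul, mul_zero, neg_mul, one_mul,
    intervalIntegral.integral_neg, h2]
  ring

/-! ### Density of the cosines in `L²(0,1)` -/

theorem cls_add {f g : ℝ → ℝ} (hf : ContinuousOn f (Icc 0 1)) (hg : ContinuousOn g (Icc 0 1)) :
    cls (fun x => f x + g x) = cls f + cls g := by
  refine (cls_eq_iff (f := fun x => f x + g x) (hf.add hg)).2 ?_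
  filter_upwards [Lp.coeFn_add (cls f) (cls g), cls_ae hf, cls_ae hg] with x h1 h2 h3
  rw [h1, Pi.add_apply, h2, h3]

theorem cls_smul (r : ℝ) {f : ℝ → ℝ} (hf : ContinuousOn f (Icc 0 1)) :
    cls (fun x => r * f x) = r • cls f := by
  refine (cls_eq_iff (f := fun x => r * f x) (continuousOn_const.mul hf)).2 ?_
  filter_upwards [Lp.coeFn_smul r (cls f), cls_ae hf] with x h1 h2
  rw [h1, Pi.smul_apply, h2, smul_eq_mul]

theorem cls_sub {f g : ℝ → ℝ} (hf : ContinuousOn f (Icc 0 1)) (hg : ContinuousOn g (Icc 0 1)) :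
    cls (fun x => f x - g x) = cls f - cls g := by
  refine (cls_eq_iff (f := fun x => f x - g x) (hf.sub hg)).2 ?_
  filter_upwards [Lp.coeFn_sub (cls f) (cls g), cls_ae hf, cls_ae hg] with x h1 h2 h3
  rw [h1, Pi.sub_apply, h2, h3]

theorem dense_cls_continuous : Dense {w : L2 | ∃ f : ℝ → ℝ, Continuous f ∧ cls f = w} := by
  refine (Lp.boundedContinuousFunction_dense ℝ μ₀₁ (p := 2) (by norm_num)).mono ?_
  rintro w hw
  obtain ⟨g, hg⟩ := Lp.mem_boundedContinuousFunction_iff.1 hw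
  refine ⟨g, g.continuous, (cls_eq_iff g.continuous.continuousOn).2 ?_⟩
  rw [← hg]
  exact (ContinuousMap.coeFn_toAEEqFun μ₀₁ g.toContinuousMap).symm

theorem eq_zero_of_continuous {W : Type*} [NormedAddCommGroup W] [NormedSpace ℝ W]
    (Φ : L2 →L[ℝ] W) (h : ∀ f : ℝ → ℝ, Continuous f → Φ (cls f) = 0) : Φ = 0 := by
  ext1 w
  have : (Φ : L2 → W) = fun _ => 0 := by
    refine Continuous.ext_on dense_cls_continuous Φ.continuous continuous_const ?_
    rintro w ⟨f, hf, rfl⟩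
    exact h f hf
  rw [this]; rfl

/-- Product-to-sum formulas bring all polynomials in `cos(πx)` into the kernel of `Φ`, and these are
uniformly dense by Weierstrass. -/
theorem eq_zero_of_cos {W : Type*} [NormedAddCommGroup W] [NormedSpace ℝ W]
    (Φ : L2 →L[ℝ] W) (h : ∀ j : ℤ, Φ (cls fun x => Real.cos (j * (Real.pi * x))) = 0) : Φ = 0 := by
  have h1 : ∀ (n : ℕ) (j : ℤ),
      Φ (cls fun x => Real.cos (Real.pi * x) ^ n * Real.cos (j * (Real.pi * x))) = 0 := by
    intro n
    induction n with
    | zero => simpa using h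
    | succ n ih =>
      intro j
      have e : (fun x => Real.cos (Real.pi * x) ^ (n + 1) * Real.cos (j * (Real.pi * x))) =
          fun x => (1 / 2) * (Real.cos (Real.pi * x) ^ n * Real.cos ((j + 1 : ℤ) * (Real.pi * x)) +
            Real.cos (Real.pi * x) ^ n * Real.cos ((j - 1 : ℤ) * (Real.pi * x))) := by
        funext x
        push_cast
        rw [add_mul, sub_mul, one_mul, Real.cos_add, Real.cos_sub]
        ring
      rw [e, cls_smul _ (Continuous.continuousOn (by fun_prop)),
        cls_add (Continuous.continuousOn (by fun_prop)) (Continuous.continuousOn (by fun_prop)),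
        map_smul, map_add, ih, ih]
      simp
  have h2 : ∀ p : Polynomial ℝ, Φ (cls fun x => p.eval (Real.cos (Real.pi * x))) = 0 := by
    intro p
    induction p using Polynomial.induction_on' with
    | add p q hp hq =>
      simp only [Polynomial.eval_add]
      rw [cls_add (Continuous.continuousOn (by fun_prop)) (Continuous.continuousOn (by fun_prop)),
        map_add, hp, hq, add_zero]
    | monomial n a =>
      simp only [Polynomial.eval_monomial]
      rw [cls_smul _ (Continuous.continuousOn (by fun_prop)), map_smul]
      have := h1 n 0
      simp only [Int.cast_zero, zero_mul, Real.cos_zero, mul_one] at this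
      rw [this, smul_zero]
  refine eq_zero_of_continuous Φ fun f hf => ?_
  refine norm_le_zero_iff.1 (le_of_forall_pos_le_add fun ε hε => ?_)
  rw [zero_add]
  -- The substitution `t = cos(πx)` is a bijection from `[0,1]` onto `[-1,1]`, which turns `f` into
  -- a continuous function of `t`.
  obtain ⟨p, hp⟩ := exists_polynomial_near_of_continuousOn (-1) 1
    (fun t => f (Real.arccos t / Real.pi)) (Continuous.continuousOn (by fun_prop))
    (ε / (‖Φ‖ + 1)) (by positivity)
  have hc : ContinuousOn (fun x => p.eval (Real.cos (Real.pi * x))) (Icc 0 1) :=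
    Continuous.continuousOn (by fun_prop)
  have e : Φ (cls f) = Φ (cls fun x => f x - p.eval (Real.cos (Real.pi * x))) := by
    rw [cls_sub hf.continuousOn hc, map_sub, h2, sub_zero]
  rw [e]
  calc _ ≤ ‖Φ‖ * (ε / (‖Φ‖ + 1)) := by
        refine Φ.le_opNorm_of_le (norm_cls_le (hf.continuousOn.sub hc) (by positivity) ?_)
        intro x hx
        have := hp (Real.cos (Real.pi * x)) ⟨Real.neg_one_le_cos _, Real.cos_le_one _⟩
        rw [Real.arccos_cos (by have := hx.1; positivity)
          (mul_le_of_le_one_right Real.pi_pos.le hx.2), mul_div_cancel_left₀ _ Real.pi_ne_zero,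
          abs_sub_comm] at this
        exact this.le
    _ ≤ ε := by
        rw [mul_div_assoc', div_le_iff₀ (by positivity)]
        nlinarith [norm_nonneg Φ]

/-! ### Eigenfunctions of the second derivative -/

/-- The solution of `φ'' = μ φ`, `φ(0) = 1`, `φ'(0) = 0`. -/
def phi (μ x : ℝ) : ℝ :=
  if 0 ≤ μ then Real.cosh (Real.sqrt μ * x) else Real.cos (Real.sqrt (-μ) * x)

theorem phi_neg_sq (s x : ℝ) : phi (-s ^ 2) x = Real.cos (s * x) := by
  rcases eq_or_ne s 0 with rfl | hs
  · simp [phi]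
  · have : ¬ 0 ≤ -s ^ 2 := by have := pow_pos (abs_pos.2 hs) 2; rw [sq_abs] at this; linarith
    rw [phi, if_neg this, neg_neg, Real.sqrt_sq_eq_abs]
    rcases abs_choice s with h | h <;> rw [h]
    rw [neg_mul, Real.cos_neg]

theorem continuous_phi (μ : ℝ) : Continuous (phi μ) := by
  unfold phi
  split_ifs <;> fun_prop

theorem phi_zero (μ : ℝ) : phi μ 0 = 1 := by
  unfold phi
  split_ifs <;> simp

theorem hasSum_phi (μ x : ℝ) :
    HasSum (fun m : ℕ => (μ * x ^ 2) ^ m / ((2 * m).factorial : ℝ)) (phi μ x) := by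
  unfold phi
  split_ifs with h
  · convert Real.hasSum_cosh (Real.sqrt μ * x) using 3 with m
    rw [pow_mul, mul_pow (Real.sqrt μ), Real.sq_sqrt h]
  · convert Real.hasSum_cos (Real.sqrt (-μ) * x) using 2 with m
    rw [pow_mul, mul_pow (Real.sqrt (-μ)), Real.sq_sqrt (by linarith), ← mul_pow]
    ring_nf

theorem phi_eq_add_cconv (μ x : ℝ) : phi μ x = 1 + cconv (fun x => x) (fun y => μ * phi μ y) x := by
  by_cases h : 0 ≤ μ
  · have := eq_add_cconv_of_hasDerivAt (f := phi μ)
      (f' := fun x => Real.sqrt μ * Real.sinh (Real.sqrt μ * x)) (g := fun y => μ * phi μ y)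
      ?_ ?_ (continuous_const.mul (continuous_phi μ)) (by simp) x
    · rwa [phi_zero] at this
    · intro x
      unfold phi
      simp only [h, if_true]
      have := ((hasDerivAt_id x).const_mul (Real.sqrt μ)).cosh
      simpa [mul_comm] using this
    · intro x
      unfold phi
      simp only [h, if_true]
      have := (((hasDerivAt_id x).const_mul (Real.sqrt μ)).sinh).const_mul (Real.sqrt μ)
      refine this.congr_deriv ?_
      simp only [id_eq, mul_one]
      linear_combination (Real.cosh (Real.sqrt μ * x)) * Real.mul_self_sqrt h
  · have := eq_add_cconv_of_hasDerivAt (f := phi μ)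
      (f' := fun x => -Real.sqrt (-μ) * Real.sin (Real.sqrt (-μ) * x)) (g := fun y => μ * phi μ y)
      ?_ ?_ (continuous_const.mul (continuous_phi μ)) (by simp) x
    · rwa [phi_zero] at this
    · intro x
      unfold phi
      simp only [h, if_false]
      have := ((hasDerivAt_id x).const_mul (Real.sqrt (-μ))).cos
      simpa [mul_comm] using this
    · intro x
      unfold phi
      simp only [h, if_false]
      have := (((hasDerivAt_id x).const_mul (Real.sqrt (-μ))).sin).const_mul (-Real.sqrt (-μ))
      refine this.congr_deriv ?_
      simp only [id_eq, mul_one]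
      linear_combination -Real.cos (Real.sqrt (-μ) * x) *
        Real.mul_self_sqrt (show 0 ≤ -μ by linarith)

/-- The values `μ = -s²` already give all cosines. Leaving out `μ = 0` costs nothing, since `1` is
the uniform limit of `cos(sx)` as `s → 0`; the restriction later permits division by `μ`. -/
theorem eq_zero_of_phi {W : Type*} [NormedAddCommGroup W] [NormedSpace ℝ W]
    (Φ : L2 →L[ℝ] W) (h : ∀ μ : ℝ, μ ≠ 0 → Φ (cls (phi μ)) = 0) : Φ = 0 := by
  have h' : ∀ s : ℝ, s ≠ 0 → Φ (cls fun x => Real.cos (s * x)) = 0 := by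
    intro s hs
    rw [← h (-s ^ 2) (neg_ne_zero.2 (pow_ne_zero 2 hs))]
    congr 2
    funext x
    rw [phi_neg_sq]
  have h1 : Φ (cls fun _ => 1) = 0 := by
    have hs : ∀ s : ℝ, s ≠ 0 → ‖Φ (cls fun _ => 1)‖ ≤ ‖Φ‖ * (s ^ 2 / 2) := by
      intro s hs
      have hc : ContinuousOn (fun x => Real.cos (s * x)) (Icc 0 1) :=
        Continuous.continuousOn (by fun_prop)
      rw [← sub_zero (Φ (cls fun _ => 1)), ← h' s hs, ← map_sub, ← cls_sub continuousOn_const hc]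
      refine Φ.le_opNorm_of_le (norm_cls_le (continuousOn_const.sub hc) (by positivity) ?_)
      intro x hx
      simp only [Pi.sub_apply]
      rw [abs_of_nonneg (sub_nonneg.2 (Real.cos_le_one _))]
      have h2 := Real.one_sub_sq_div_two_le_cos (x := s * x)
      have h3 : (s * x) ^ 2 ≤ s ^ 2 := by
        rw [mul_pow]
        exact mul_le_of_le_one_right (sq_nonneg s) (pow_le_one₀ hx.1 hx.2)
      linarith
    have ht : Tendsto (fun s : ℝ => ‖Φ‖ * (s ^ 2 / 2)) (𝓝[≠] 0) (𝓝 (‖Φ‖ * (0 ^ 2 / 2))) :=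
      tendsto_nhdsWithin_of_tendsto_nhds (Continuous.tendsto (by fun_prop) 0)
    have := ge_of_tendsto ht (eventually_mem_nhdsWithin.mono hs)
    exact norm_le_zero_iff.1 (by simpa using this)
  refine eq_zero_of_cos Φ fun j => ?_
  rcases eq_or_ne j 0 with rfl | hj
  · simpa using h1
  · simp only [← mul_assoc]
    exact h' _ (mul_ne_zero (by exact_mod_cast hj) Real.pi_ne_zero)

theorem smul_dint_phi (μ : ℝ) : μ • dint (cls (phi μ)) = cls (phi μ) - one := by
  have hc := continuous_phi μ
  have h1 : Continuous (cconv (fun x => x) (phi μ)) := continuous_cconv continuous_id hc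
  rw [dint, conv_cls _ hc, ← cls_smul _ h1.continuousOn, one,
    ← cls_sub hc.continuousOn continuousOn_const]
  congr 1
  funext x
  rw [phi_eq_add_cconv, cconv, cconv, ← intervalIntegral.integral_const_mul]
  ring_nf

/-! ### The Bessel kernel -/

theorem summable_besselRatio_abs (v : ℝ) :
    Summable fun m : ℕ => |v / 4| ^ m / ((m.factorial : ℝ) * ((m + 1).factorial : ℝ)) := by
  refine Summable.of_nonneg_of_le (fun m => by positivity) (fun m => ?_)
    (Real.summable_pow_div_factorial |v / 4|)
  refine div_le_div_of_nonneg_left (by positivity) (by positivity) ?_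
  exact le_mul_of_one_le_right (by positivity) (by exact_mod_cast (m + 1).factorial_pos)

theorem summable_besselRatio (v : ℝ) :
    Summable fun m : ℕ => (v / 4) ^ m / ((m.factorial : ℝ) * ((m + 1).factorial : ℝ)) := by
  refine Summable.of_norm ((summable_besselRatio_abs v).congr fun m => ?_)
  rw [norm_div, norm_pow, Real.norm_eq_abs, Real.norm_of_nonneg (by positivity)]

theorem continuous_besselRatio : Continuous besselRatio := by
  refine continuous_const.mul (continuous_iff_continuousAt.2 fun v => ?_)
  have h : ContinuousOn (fun v : ℝ => ∑' m : ℕ, (v / 4) ^ m /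
      ((m.factorial : ℝ) * ((m + 1).factorial : ℝ))) (Icc (-(|v| + 1)) (|v| + 1)) := by
    refine continuousOn_tsum (fun m => Continuous.continuousOn (by fun_prop))
      (summable_besselRatio_abs (|v| + 1)) fun m w hw => ?_
    rw [norm_div, norm_pow, Real.norm_eq_abs,
      Real.norm_of_nonneg (show (0 : ℝ) ≤ (m.factorial : ℝ) * ((m + 1).factorial : ℝ) by positivity)]
    gcongr ?_ ^ m / _
    rw [abs_div, abs_div]
    exact div_le_div_of_nonneg_right ((abs_le.2 hw).trans (le_abs_self _)) (abs_nonneg _)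
  exact h.continuousAt (Icc_mem_nhds (by linarith [neg_abs_le v]) (by linarith [le_abs_self v]))

/-- The kernel `-κ x I₁(√(κ(x²-y²))) / √(κ(x²-y²))`. -/
def besselKer (κ x y : ℝ) : ℝ := -κ * x * besselRatio (κ * (x ^ 2 - y ^ 2))

theorem continuous_besselKer (κ : ℝ) : Continuous fun p : ℝ × ℝ => besselKer κ p.1 p.2 := by
  have := continuous_besselRatio
  unfold besselKer
  fun_prop

theorem integral_pow_mul_pow (x : ℝ) (m j : ℕ) :
    ∫ y in (0 : ℝ)..x, (x ^ 2 - y ^ 2) ^ m * y ^ (2 * j) =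
      x ^ (2 * (m + j) + 1) * (m.factorial * 4 ^ m * (2 * j).factorial * (m + j).factorial /
        (j.factorial * (2 * (m + j) + 1).factorial)) := by
  induction m generalizing j with
  | zero =>
    simp only [pow_zero, one_mul, integral_pow, zero_add, Nat.factorial_succ (2 * j)]
    have := Nat.factorial_ne_zero j
    have := Nat.factorial_ne_zero (2 * j)
    push_cast
    field_simp
    simp
  | succ m ih =>
    -- This primitive vanishes at both ends, which links the exponents `(m+1, j)` to `(m, j+1)`.
    have h := intervalIntegral.integral_eq_sub_of_hasDerivAt (a := 0) (b := x)
      (f := fun y => (x ^ 2 - y ^ 2) ^ (m + 1) * y ^ (2 * j + 1))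
      (f' := fun y => (2 * j + 1) * ((x ^ 2 - y ^ 2) ^ (m + 1) * y ^ (2 * j)) -
        2 * (m + 1) * ((x ^ 2 - y ^ 2) ^ m * y ^ (2 * (j + 1)))) ?_
      (Continuous.intervalIntegrable (by fun_prop) _ _)
    · rw [intervalIntegral.integral_sub (Continuous.intervalIntegrable (by fun_prop) _ _)
        (Continuous.intervalIntegrable (by fun_prop) _ _), intervalIntegral.integral_const_mul,
        intervalIntegral.integral_const_mul, ih] at h
      simp only [sub_self, ne_eq, Nat.add_eq_zero_iff, one_ne_zero, and_false, not_false_eq_true,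
        zero_pow, zero_mul, mul_zero] at h
      have h2 : (2 * (j : ℝ) + 1) ≠ 0 := by positivity
      rw [← mul_right_inj' h2, sub_eq_zero.1 h, Nat.factorial_succ m, Nat.factorial_succ j,
        show 2 * (j + 1) = 2 * j + 1 + 1 by ring, Nat.factorial_succ (2 * j + 1),
        Nat.factorial_succ (2 * j), show m + 1 + j = m + (j + 1) by ring]
      have := Nat.factorial_ne_zero j
      have := Nat.factorial_ne_zero (2 * (m + (j + 1)) + 1)
      push_cast
      field_simp
      ring
    · intro y _
      have h1 := ((((hasDerivAt_id y).pow 2).const_sub (x ^ 2)).pow (m + 1)).mul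
        ((hasDerivAt_id y).pow (2 * j + 1))
      refine h1.congr_deriv ?_
      simp only [id_eq, Pi.pow_apply]
      push_cast
      ring

/-- The series of `∫₀ˣ besselRatio(κ(x²-y²)) φ_μ(y) dy`. -/
theorem hasSum_integral_besselRatio_mul_phi (κ μ : ℝ) {x : ℝ} (hx : 0 ≤ x) :
    HasSum (fun p : ℕ × ℕ => κ ^ p.1 * μ ^ p.2 * x ^ (2 * (p.1 + p.2) + 1) * (p.1 + p.2).factorial /
        ((p.1 + 1).factorial * p.2.factorial * (2 * (p.1 + p.2) + 1).factorial))
      (2 * ∫ y in (0 : ℝ)..x, besselRatio (κ * (x ^ 2 - y ^ 2)) * phi μ y) := by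
  have hb := summable_besselRatio_abs (|κ| * x ^ 2)
  have hp := (hasSum_phi |μ| x).summable
  -- For `0 ≤ y ≤ x` every term is at most its analogue with `|κ|x²` and `|μ|x²`, a bound constant
  -- in `y` and summable over pairs. This justifies termwise integration.
  have hprod := hb.mul_of_nonneg hp (fun m => by positivity) (fun m => by positivity)
  rw [← intervalIntegral.integral_const_mul]
  have main := intervalIntegral.hasSum_integral_of_dominated_convergence (μ := volume)
    (a := 0) (b := x)
    (F := fun (p : ℕ × ℕ) y => (κ * (x ^ 2 - y ^ 2) / 4) ^ p.1 /
        ((p.1.factorial : ℝ) * ((p.1 + 1).factorial : ℝ)) *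
          ((μ * y ^ 2) ^ p.2 / ((2 * p.2).factorial : ℝ)))
    (f := fun y => 2 * (besselRatio (κ * (x ^ 2 - y ^ 2)) * phi μ y)) _
    (fun p => (Continuous.aestronglyMeasurable (by fun_prop)))
    (fun p => Eventually.of_forall fun y hy => ?_) (Eventually.of_forall fun _ _ => hprod)
    (intervalIntegrable_const) (Eventually.of_forall fun y _ => ?_)
  · refine main.congr_fun ?_
    rintro ⟨m, j⟩
    have e : ∀ y : ℝ, (κ * (x ^ 2 - y ^ 2) / 4) ^ m / ((m.factorial : ℝ) * ((m + 1).factorial : ℝ)) *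
        ((μ * y ^ 2) ^ j / ((2 * j).factorial : ℝ)) =
        (κ ^ m * μ ^ j / (4 ^ m * m.factorial * (m + 1).factorial * (2 * j).factorial)) *
        ((x ^ 2 - y ^ 2) ^ m * y ^ (2 * j)) := by
      intro y
      rw [div_pow, mul_pow, mul_pow, ← pow_mul]
      field_simp
    simp only [e]
    rw [intervalIntegral.integral_const_mul, integral_pow_mul_pow]
    have := Nat.factorial_ne_zero j
    have := Nat.factorial_ne_zero m
    have := Nat.factorial_ne_zero (2 * j)
    field_simp
  · rw [uIoc_of_le hx] at hy
    have hy2 : y ^ 2 ≤ x ^ 2 := pow_le_pow_left₀ hy.1.le hy.2 2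
    rw [norm_mul, norm_div, norm_div, norm_pow, norm_pow]
    simp only [Real.norm_eq_abs]
    rw [abs_of_nonneg (show (0 : ℝ) ≤ (p.1.factorial : ℝ) * ((p.1 + 1).factorial : ℝ) by positivity),
      abs_of_nonneg (show (0 : ℝ) ≤ ((2 * p.2).factorial : ℝ) by positivity)]
    have h1 : |κ * (x ^ 2 - y ^ 2) / 4| ≤ |(|κ| * x ^ 2) / 4| := by
      rw [abs_div, abs_div, abs_mul, abs_mul, abs_abs, abs_of_nonneg (sub_nonneg.2 hy2),
        abs_of_nonneg (sq_nonneg x)]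
      gcongr
      linarith [sq_nonneg y]
    have h2 : |μ * y ^ 2| ≤ |μ| * x ^ 2 := by
      rw [abs_mul, abs_of_nonneg (sq_nonneg y)]
      gcongr
    gcongr
  · have h1 := (summable_besselRatio (κ * (x ^ 2 - y ^ 2))).hasSum
    have h2 := hasSum_phi μ y
    have h3 : Summable fun p : ℕ × ℕ => (κ * (x ^ 2 - y ^ 2) / 4) ^ p.1 /
        ((p.1.factorial : ℝ) * ((p.1 + 1).factorial : ℝ)) *
          ((μ * y ^ 2) ^ p.2 / ((2 * p.2).factorial : ℝ)) :=
      summable_mul_of_summable_norm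
        (f := fun m : ℕ => (κ * (x ^ 2 - y ^ 2) / 4) ^ m / ((m.factorial : ℝ) * ((m + 1).factorial : ℝ)))
        (g := fun j : ℕ => (μ * y ^ 2) ^ j / ((2 * j).factorial : ℝ)) h1.summable.norm h2.summable.norm
    have := h1.mul h2 h3
    refine (congrArg (HasSum _) ?_).mp this
    rw [besselRatio]
    ring

theorem hasSum_phi_sub (κ μ x : ℝ) :
    HasSum (fun N : ℕ => ((μ + κ) ^ (N + 1) - μ ^ (N + 1)) * x ^ (2 * (N + 1)) /
      ((2 * (N + 1)).factorial : ℝ)) (phi (μ + κ) x - phi μ x) := by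
  have h := ((hasSum_nat_add_iff' 1).2 (hasSum_phi (μ + κ) x)).sub
    ((hasSum_nat_add_iff' 1).2 (hasSum_phi μ x))
  simp only [Finset.sum_range_one, mul_zero, pow_zero, Nat.factorial_zero, Nat.cast_one,
    sub_sub_sub_cancel_right] at h
  refine h.congr_fun fun N => ?_
  rw [mul_pow, mul_pow, ← pow_mul]
  ring

/-- Grouping the double series along `m + j = N` makes the coefficients binomial, and the sum is the
power series of `phi (μ + κ) - phi μ`. -/
theorem voltFun_besselKer_phi (κ μ : ℝ) {x : ℝ} (hx : 0 ≤ x) :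
    voltFun (besselKer κ) (phi μ) x = phi μ x - phi (μ + κ) x := by
  have h := (hasSum_integral_besselRatio_mul_phi κ μ hx).mul_left (κ * x / 2)
  rw [← Finset.HasAntidiagonal.sigmaAntidiagonalEquivProd.hasSum_iff] at h
  have h2 := h.sigma fun N => hasSum_fintype _
  have h3 := h2.unique ((hasSum_phi_sub κ μ x).congr_fun fun N => ?_)
  · have e : voltFun (besselKer κ) (phi μ) x =
        -(κ * x / 2 * (2 * ∫ y in (0 : ℝ)..x, besselRatio (κ * (x ^ 2 - y ^ 2)) * phi μ y)) := by
      rw [← mul_assoc, ← neg_mul, ← intervalIntegral.integral_const_mul, voltFun]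
      refine intervalIntegral.integral_congr fun y _ => ?_
      simp only [besselKer]
      ring
    rw [e, h3, neg_sub]
  · simp only [Function.comp_apply, Finset.HasAntidiagonal.sigmaAntidiagonalEquivProd_apply]
    rw [Finset.sum_coe_sort (Finset.HasAntidiagonal.antidiagonal N) (fun p : ℕ × ℕ => κ * x / 2 *
      (κ ^ p.1 * μ ^ p.2 * x ^ (2 * (p.1 + p.2) + 1) * (p.1 + p.2).factorial /
        ((p.1 + 1).factorial * p.2.factorial * (2 * (p.1 + p.2) + 1).factorial)))]
    -- The binomial expansion without its term free of `κ`; hence the shift `p.1 + 1`.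
    have hb : (μ + κ) ^ (N + 1) - μ ^ (N + 1) =
        ∑ p ∈ Finset.HasAntidiagonal.antidiagonal N, ((N + 1).choose (p.1 + 1) : ℝ) * (κ ^ (p.1 + 1) * μ ^ p.2) := by
      rw [add_comm μ κ, (Commute.all κ μ).add_pow', Finset.Nat.sum_antidiagonal_succ]
      simp
    rw [hb, Finset.sum_mul, Finset.sum_div]
    refine Finset.sum_congr rfl fun p hp => ?_
    obtain ⟨m, j⟩ := p
    rw [Finset.HasAntidiagonal.mem_antidiagonal] at hp
    simp only at hp ⊢
    subst hp
    have hc : ((m + j + 1).choose (m + 1) : ℝ) * ((m + 1).factorial * j.factorial) =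
        (m + j + 1).factorial := by
      have := Nat.choose_mul_factorial_mul_factorial (show m + 1 ≤ m + j + 1 by omega)
      rw [show m + j + 1 - (m + 1) = j by omega, mul_assoc] at this
      exact_mod_cast this
    rw [eq_div_of_mul_eq (by positivity) hc, show 2 * (m + j + 1) = 2 * (m + j) + 1 + 1 by ring,
      Nat.factorial_succ (2 * (m + j) + 1), Nat.factorial_succ (m + j)]
    have := Nat.factorial_ne_zero (2 * (m + j) + 1)
    push_cast
    field_simp
    ring

/-! ### The Bessel transformation -/

/-- The Volterra operator with the Bessel kernel. -/
def besselOp (κ : ℝ) : L2 →L[ℝ] L2 := volt (besselKer κ) (continuous_besselKer κ)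

/-- The transformation `w ↦ w - ∫₀ˣ q(x,y) w(y) dy`. -/
def besselT (κ : ℝ) : L2 →L[ℝ] L2 := ContinuousLinearMap.id ℝ L2 - besselOp κ

theorem besselT_apply (κ : ℝ) (w : L2) : besselT κ w = w - besselOp κ w := rfl

theorem besselT_phi (κ μ : ℝ) : besselT κ (cls (phi μ)) = cls (phi (μ + κ)) := by
  have h : besselOp κ (cls (phi μ)) = cls fun x => phi μ x - phi (μ + κ) x :=
    volt_cls _ (continuous_phi μ).continuousOn
      ((continuous_phi μ).sub (continuous_phi (μ + κ))).continuousOn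
      fun x hx => voltFun_besselKer_phi κ μ hx.1
  rw [besselT_apply, h, cls_sub (continuous_phi _).continuousOn (continuous_phi _).continuousOn,
    sub_sub_cancel]

/-- On the dense family the parameter is shifted by `κ` and back by `-κ`. This is how `l` becomes
the inverse kernel of `q`. -/
theorem besselT_neg_besselT (κ : ℝ) (w : L2) : besselT (-κ) (besselT κ w) = w := by
  have h := eq_zero_of_phi (besselT (-κ) ∘L besselT κ - ContinuousLinearMap.id ℝ L2) fun μ _ => by
    simp [besselT_phi]
  have := DFunLike.congr_fun h w
  simpa [sub_eq_zero] using this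

theorem phi_zero_left : cls (phi 0) = one := by
  rw [one]; congr 1; funext x; simp [phi]

theorem besselT_one (κ : ℝ) : besselT κ one = one + κ • dint (besselT κ one) := by
  rw [← phi_zero_left, besselT_phi, zero_add, smul_dint_phi, phi_zero_left]
  abel

/-- An integrated form of the intertwining of `d²/dx²` with `d²/dx² - κ`. On `phi μ` both sides,
multiplied by `μ`, equal `phi (μ + κ) - phi κ`. -/
theorem besselT_dint (κ : ℝ) (g : L2) :
    besselT κ (dint g) = dint (besselT κ (g + κ • dint g)) := by
  suffices h : ∀ μ ≠ 0, besselT κ (dint (cls (phi μ))) =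
      dint (besselT κ (cls (phi μ) + κ • dint (cls (phi μ)))) by
    let Φ : L2 →L[ℝ] L2 := besselT κ ∘L dint -
      dint ∘L besselT κ ∘L (ContinuousLinearMap.id ℝ L2 + κ • dint)
    have hΦ : ∀ w, Φ w = besselT κ (dint w) - dint (besselT κ (w + κ • dint w)) := fun w => rfl
    have h0 : Φ = 0 := by
      refine eq_zero_of_phi Φ fun μ hμ => ?_
      rw [hΦ, h μ hμ, sub_self]
    have := hΦ g
    rw [h0] at this
    exact sub_eq_zero.1 this.symm
  intro μ hμ
  have hd : ∀ μ, μ • dint (cls (phi μ)) = cls (phi μ) - one := smul_dint_phi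
  refine (smul_right_injective L2 hμ) ?_
  have e1 : μ • besselT κ (dint (cls (phi μ))) = cls (phi (μ + κ)) - cls (phi κ) := by
    rw [← map_smul, hd, ← phi_zero_left, map_sub, besselT_phi, besselT_phi, zero_add]
  have e2 : besselT κ (μ • (cls (phi μ) + κ • dint (cls (phi μ)))) =
      (μ + κ) • cls (phi (μ + κ)) - κ • cls (phi κ) := by
    rw [smul_add, smul_comm μ κ, hd, ← phi_zero_left, map_add, map_smul, map_smul, map_sub,
      besselT_phi, besselT_phi, zero_add, add_smul, smul_sub, add_sub_assoc]
  have e3 : μ • dint (besselT κ (cls (phi μ) + κ • dint (cls (phi μ)))) =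
      cls (phi (μ + κ)) - cls (phi κ) := by
    rw [← map_smul, ← map_smul, e2, map_sub, map_smul, map_smul, hd, hd, sub_sub_sub_cancel_right]
  exact e1.trans e3.symm

/-- The transformation keeps the value at `0` and the zero slope, and turns the second derivative
`g` of `v` into the transform of `g + κv`. -/
theorem besselT_affine (κ f₀ : ℝ) (g : L2) :
    besselT κ (f₀ • one + dint g) =
      f₀ • one + dint (besselT κ (g + κ • (f₀ • one + dint g))) := by
  rw [map_add, map_smul, besselT_dint]
  conv_lhs => rw [besselT_one]
  simp only [map_add, map_smul, smul_add]
  rw [smul_comm f₀ κ]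
  abel

open scoped InnerProductSpace

/-! ### Energy identity and Wirtinger's inequality -/

theorem inner_eq_integral (v w : L2) : ⟪v, w⟫_ℝ = ∫ x in (0 : ℝ)..1, v x * w x := by
  rw [L2.inner_def, integral_unit]
  exact intervalIntegral.integral_congr fun x _ => by simp [mul_comm]

theorem inner_cls {f : ℝ → ℝ} (hf : ContinuousOn f (Icc 0 1)) (w : L2) :
    ⟪cls f, w⟫_ℝ = ∫ x in (0 : ℝ)..1, f x * w x := by
  rw [inner_eq_integral]
  exact integral_congr_unit ((cls_ae hf).mono fun x hx => by simp only [hx]) ⟨zero_le_one, le_rfl⟩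

theorem norm_sq_eq_integral {v : L2} {f : ℝ → ℝ} (h : v =ᵐ[μ₀₁] f) :
    ‖v‖ ^ 2 = ∫ x in (0 : ℝ)..1, f x ^ 2 := by
  rw [← real_inner_self_eq_norm_sq, inner_eq_integral]
  exact integral_congr_unit (h.mono fun x hx => by simp only [hx, sq]) ⟨zero_le_one, le_rfl⟩

/-- Integration from `0`. -/
def prim : L2 →L[ℝ] L2 := conv (fun _ => 1) continuous_const

theorem prim_ae (g : L2) : prim g =ᵐ[μ₀₁] fun x => ∫ y in (0 : ℝ)..x, g y := by
  have : prim g =ᵐ[μ₀₁] fun x => ∫ y in (0 : ℝ)..x, 1 * g y := conv_ae continuous_const g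
  simpa only [one_mul] using this

theorem dint_eq_prim_prim (g : L2) : dint g = prim (prim g) := dint_eq g

theorem norm_one : ‖one‖ = 1 := by
  have h := norm_sq_eq_integral (cls_ae (f := fun _ => (1 : ℝ)) continuousOn_const)
  rw [← sq_eq_sq₀ (norm_nonneg _) zero_le_one, one, h]
  simp

/-- Both sides are continuous in `g`, and for continuous `g` this is one integration by parts, with
`prim g` in the role of the first derivative. -/
theorem inner_dint_self (g : L2) :
    ⟪dint g, g⟫_ℝ = ⟪one, prim g⟫_ℝ * ⟪one, g⟫_ℝ - ‖prim g‖ ^ 2 := by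
  have hL : Continuous fun g : L2 => ⟪dint g, g⟫_ℝ := by fun_prop
  have hR : Continuous fun g : L2 => ⟪one, prim g⟫_ℝ * ⟪one, g⟫_ℝ - ‖prim g‖ ^ 2 := by fun_prop
  refine congrFun (Continuous.ext_on dense_cls_continuous hL hR ?_) g
  rintro _ ⟨g, hg, rfl⟩
  have hp : prim (cls g) = cls fun x => ∫ y in (0 : ℝ)..x, g y := by
    refine (conv_cls _ hg).trans ?_
    congr 1
    funext x
    simp [cconv]
  have hA : ∀ x, HasDerivAt (fun x => ∫ y in (0 : ℝ)..x, g y) (g x) x :=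
    hasDerivAt_integral_of_continuous hg
  have hAc : Continuous fun x => ∫ y in (0 : ℝ)..x, g y :=
    continuous_iff_continuousAt.2 fun x => (hA x).continuousAt
  have hB : ∀ x, HasDerivAt (fun x => ∫ s in (0 : ℝ)..x, ∫ y in (0 : ℝ)..s, g y)
      (∫ y in (0 : ℝ)..x, g y) x :=
    hasDerivAt_integral_of_continuous hAc
  have hBc : Continuous fun x => ∫ s in (0 : ℝ)..x, ∫ y in (0 : ℝ)..s, g y :=
    continuous_iff_continuousAt.2 fun x => (hB x).continuousAt
  have hd : dint (cls g) = cls fun x => ∫ s in (0 : ℝ)..x, ∫ y in (0 : ℝ)..s, g y := by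
    rw [dint_eq_prim_prim, hp]
    refine (conv_cls _ hAc).trans ?_
    congr 1
    funext x
    simp [cconv]
  have hibp := intervalIntegral.integral_mul_deriv_eq_deriv_mul (a := 0) (b := 1)
    (fun x _ => hB x) (fun x _ => hA x) (hAc.intervalIntegrable _ _) (hg.intervalIntegrable _ _)
  have hone : ∀ f : ℝ → ℝ, Continuous f → ⟪one, cls f⟫_ℝ = ∫ x in (0 : ℝ)..1, f x := by
    intro f hf
    rw [real_inner_comm, one, inner_cls hf.continuousOn]
    refine integral_congr_unit ((cls_ae (f := fun _ => (1 : ℝ)) continuousOn_const).mono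
      fun x hx => ?_) ⟨zero_le_one, le_rfl⟩
    simp only [hx, mul_one]
  simp only
  rw [hd, hp, hone _ hAc, hone _ hg, norm_sq_eq_integral (cls_ae hAc.continuousOn),
    inner_cls hBc.continuousOn,
    integral_congr_unit ((cls_ae hg.continuousOn).mono fun x hx => by rw [hx])
      ⟨zero_le_one, le_rfl⟩, hibp]
  simp [sq]

theorem inner_one (g : L2) : ⟪one, g⟫_ℝ = ∫ x in (0 : ℝ)..1, g x := by
  rw [one, inner_cls continuousOn_const]
  simp

theorem inner_one_prim (g : L2) : ⟪one, prim g⟫_ℝ = ∫ y in (0 : ℝ)..1, (1 - y) * g y := by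
  rw [inner_one, ← integral_integral_eq (integrable_coe g) ⟨zero_le_one, le_rfl⟩]
  exact integral_congr_unit (prim_ae g) ⟨zero_le_one, le_rfl⟩

/-- `∫₀¹ z z'' = -∫₀¹ z'²` if `z'(0) = 0` and `z(1) = 0`. -/
theorem inner_second_deriv {z₀ : ℝ} {g : L2} (h : z₀ + ∫ y in (0 : ℝ)..1, (1 - y) * g y = 0) :
    ⟪z₀ • one + dint g, g⟫_ℝ = -‖prim g‖ ^ 2 := by
  rw [← inner_one_prim] at h
  rw [inner_add_left, inner_smul_left, inner_dint_self, eq_neg_of_add_eq_zero_left h]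
  simp only [map_neg, conj_trivial]
  ring

/-- Since `z(1) = 0`, the value `z(0)` is minus the mean of `z'`; then Cauchy–Schwarz. -/
theorem sq_le_norm_prim_sq {z₀ : ℝ} {g : L2} (h : z₀ + ∫ y in (0 : ℝ)..1, (1 - y) * g y = 0) :
    z₀ ^ 2 ≤ ‖prim g‖ ^ 2 := by
  rw [← inner_one_prim] at h
  rw [eq_neg_of_add_eq_zero_left h, neg_sq, ← sq_abs]
  have := abs_real_inner_le_norm one (prim g)
  rw [norm_one, one_mul] at this
  gcongr

/-- Expand `∫(f' + s tan(sx) f)² ≥ 0`. The cross term is completed to the derivative of `s tan(sx)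
f²`, which integrates to zero because `tan 0 = 0` and `f 1 = 0`. The condition `s < π/2` keeps the
tangent finite on `[0,1]`; the sharp constant comes from `s → π/2`. -/
theorem wirtinger_aux {f A : ℝ → ℝ} (hf : ContinuousOn f (Icc 0 1))
    (hA : ContinuousOn A (Icc 0 1)) (hd : ∀ x ∈ Ioo (0 : ℝ) 1, HasDerivAt f (A x) x)
    (h1 : f 1 = 0) {s : ℝ} (hs0 : 0 ≤ s) (hs : s < Real.pi / 2) :
    s ^ 2 * ∫ x in (0 : ℝ)..1, f x ^ 2 ≤ ∫ x in (0 : ℝ)..1, A x ^ 2 := by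
  have hcos : ∀ x ∈ Icc (0 : ℝ) 1, 0 < Real.cos (s * x) := by
    intro x hx
    refine Real.cos_pos_of_mem_Ioo ⟨?_, ?_⟩
    · have := mul_nonneg hs0 hx.1
      linarith [Real.pi_pos]
    · exact (mul_le_of_le_one_right hs0 hx.2).trans_lt hs
  let T : ℝ → ℝ := fun x => Real.tan (s * x)
  have hT : ContinuousOn T (Icc 0 1) := fun x hx =>
    ((Real.continuousAt_tan.2 (hcos x hx).ne').comp
      (f := fun x => s * x) (by fun_prop)).continuousWithinAt
  have hT' : ∀ x ∈ Ioo (0 : ℝ) 1, HasDerivAt T (s * (1 + T x ^ 2)) x := by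
    intro x hx
    have hc := (hcos x (Ioo_subset_Icc_self hx)).ne'
    have := (Real.hasDerivAt_tan hc).comp x ((hasDerivAt_id x).const_mul s)
    refine this.congr_deriv ?_
    have h2 := Real.one_add_tan_sq_mul_cos_sq_eq_one hc
    simp only [T, mul_one]
    field_simp
    linear_combination -s * h2
  have hf2 : IntervalIntegrable (fun x => f x ^ 2) volume 0 1 :=
    ContinuousOn.intervalIntegrable (by rw [uIcc_of_le zero_le_one]; exact hf.pow 2)
  have hA2 : IntervalIntegrable (fun x => A x ^ 2) volume 0 1 :=
    ContinuousOn.intervalIntegrable (by rw [uIcc_of_le zero_le_one]; exact hA.pow 2)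
  have hDc : ContinuousOn (fun x => 2 * f x * A x * (s * T x) + f x ^ 2 * (s ^ 2 * (1 + T x ^ 2)))
      (Icc 0 1) := by fun_prop
  have hDi : IntervalIntegrable
      (fun x => 2 * f x * A x * (s * T x) + f x ^ 2 * (s ^ 2 * (1 + T x ^ 2))) volume 0 1 :=
    ContinuousOn.intervalIntegrable (by rw [uIcc_of_le zero_le_one]; exact hDc)
  have hftc := intervalIntegral.integral_eq_sub_of_hasDerivAt_of_le zero_le_one
    (f := fun x => f x ^ 2 * (s * T x)) (by fun_prop) (fun x hx => ?_) hDi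
  · have h0 : 0 ≤ ∫ x in (0 : ℝ)..1, (A x + s * T x * f x) ^ 2 :=
      intervalIntegral.integral_nonneg zero_le_one fun x _ => sq_nonneg _
    have e : ∀ x, (A x + s * T x * f x) ^ 2 = A x ^ 2 +
        (2 * f x * A x * (s * T x) + f x ^ 2 * (s ^ 2 * (1 + T x ^ 2))) - s ^ 2 * f x ^ 2 := by
      intro x; ring
    simp only [e] at h0
    rw [intervalIntegral.integral_sub (hA2.add hDi) (hf2.const_mul _),
      intervalIntegral.integral_add hA2 hDi, hftc, intervalIntegral.integral_const_mul, h1] at h0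
    simp only [T, mul_zero, Real.tan_zero] at h0
    linarith
  · refine (((hd x hx).pow 2).mul ((hT' x hx).const_mul s)).congr_deriv ?_
    simp only [Pi.pow_apply]
    push_cast
    ring

/-- Wirtinger's inequality for functions with `z(1) = 0`. -/
theorem wirtinger {z₀ : ℝ} {g : L2} (h : z₀ + ∫ y in (0 : ℝ)..1, (1 - y) * g y = 0) :
    Real.pi ^ 2 / 4 * ‖z₀ • one + dint g‖ ^ 2 ≤ ‖prim g‖ ^ 2 := by
  let A : ℝ → ℝ := fun x => ∫ y in (0 : ℝ)..x, g y
  have hA : ContinuousOn A (Icc 0 1) := by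
    have := voltFun_continuousOn (F := fun _ _ => 1) (by fun_prop) (integrable_coe g)
    refine this.congr fun x _ => ?_
    simp [voltFun, A]
  let f : ℝ → ℝ := fun x => z₀ + ∫ y in (0 : ℝ)..x, (x - y) * g y
  have hf : ContinuousOn f (Icc 0 1) := continuousOn_const.add (continuousOn_dint g)
  have hd : ∀ x ∈ Ioo (0 : ℝ) 1, HasDerivAt f (A x) x := by
    intro x hx
    have h2 : HasDerivAt (fun x => z₀ + ∫ y in (0 : ℝ)..x, A y) (A x) x := by
      have hi : IntervalIntegrable A volume 0 x := ContinuousOn.intervalIntegrable (by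
        rw [uIcc_of_le hx.1.le]; exact hA.mono (Icc_subset_Icc_right hx.2.le))
      refine (intervalIntegral.integral_hasDerivAt_right hi ?_
        (hA.continuousAt (Icc_mem_nhds hx.1 hx.2))).const_add z₀
      exact (hA.mono Ioo_subset_Icc_self).stronglyMeasurableAtFilter isOpen_Ioo x hx
    refine h2.congr_of_eventuallyEq ?_
    filter_upwards [Icc_mem_nhds hx.1 hx.2] with y hy
    simp only [f, A]
    rw [integral_integral_eq (integrable_coe g) hy]
  rw [norm_sq_eq_integral (affine_dint_ae z₀ g), norm_sq_eq_integral (prim_ae g)]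
  have key : ∀ s ∈ Ico 0 (Real.pi / 2),
      s ^ 2 * ∫ x in (0 : ℝ)..1, f x ^ 2 ≤ ∫ x in (0 : ℝ)..1, A x ^ 2 :=
    fun s hs => wirtinger_aux hf hA hd h hs.1 hs.2
  have ht : Tendsto (fun s : ℝ => s ^ 2 * ∫ x in (0 : ℝ)..1, f x ^ 2) (𝓝[<] (Real.pi / 2))
      (𝓝 ((Real.pi / 2) ^ 2 * ∫ x in (0 : ℝ)..1, f x ^ 2)) :=
    tendsto_nhdsWithin_of_tendsto_nhds (Continuous.tendsto (by fun_prop) _)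
  have := le_of_tendsto ht (mem_of_superset (Ico_mem_nhdsLT (by positivity)) key)
  rwa [div_pow, show (2 : ℝ) ^ 2 = 4 by norm_num] at this

/-! ### The kernels of the first backstepping transformation -/

section Exp

variable {𝔸 : Type*} [NormedRing 𝔸] [NormedAlgebra ℝ 𝔸] [CompleteSpace 𝔸] (L : 𝔸 →L[ℝ] ℝ)

theorem hasDerivAt_clm_exp (D : 𝔸) (x : ℝ) :
    HasDerivAt (fun x : ℝ => L (NormedSpace.exp (x • D))) (L (NormedSpace.exp (x • D) * D)) x :=
  L.hasFDerivAt.comp_hasDerivAt x (hasDerivAt_exp_smul_const (𝕂 := ℝ) D x)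

theorem hasDerivAt_clm_exp' (D : 𝔸) (x : ℝ) :
    HasDerivAt (fun x : ℝ => L (NormedSpace.exp (x • D))) (L (D * NormedSpace.exp (x • D))) x :=
  L.hasFDerivAt.comp_hasDerivAt x (hasDerivAt_exp_smul_const' (𝕂 := ℝ) D x)

/-- The derivative behind Duhamel's formula: the product interpolates between the exponentials `exp
(x • D')` at `y = 0` and `exp (x • D)` at `y = x`. -/
theorem hasDerivAt_clm_exp_mul_exp (D D' : 𝔸) (x y : ℝ) :
    HasDerivAt (fun y : ℝ => L (NormedSpace.exp ((x - y) • D') * NormedSpace.exp (y • D)))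
      (L (NormedSpace.exp ((x - y) • D') * ((D - D') * NormedSpace.exp (y • D)))) y := by
  have h1 : HasDerivAt (fun y : ℝ => NormedSpace.exp ((x - y) • D'))
      (-(NormedSpace.exp ((x - y) • D') * D')) y := by
    refine ((hasDerivAt_exp_smul_const (𝕂 := ℝ) D' (x - y)).scomp y
      ((hasDerivAt_id y).const_sub x)).congr_deriv ?_
    simp
  refine (L.hasFDerivAt.comp_hasDerivAt y
    (h1.mul (hasDerivAt_exp_smul_const' (𝕂 := ℝ) D y))).congr_deriv ?_
  congr 1
  noncomm_ring

end Exp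

section RowExp

open scoped Matrix

section

attribute [local instance] Matrix.linftyOpNormedRing Matrix.linftyOpNormedAlgebra

variable {m : Type*} [Fintype m] [DecidableEq m] (L : Matrix m m ℝ →ₗ[ℝ] ℝ)

/-- Composition with a linear functional leaves a real-valued derivative, so the norm on matrices is
needed only locally. -/
theorem hasDerivAt_linear_exp (D : Matrix m m ℝ) (x : ℝ) :
    HasDerivAt (fun x : ℝ => L (NormedSpace.exp (x • D))) (L (NormedSpace.exp (x • D) * D)) x :=
  hasDerivAt_clm_exp (LinearMap.toContinuousLinearMap L) D x

theorem hasDerivAt_linear_exp' (D : Matrix m m ℝ) (x : ℝ) :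
    HasDerivAt (fun x : ℝ => L (NormedSpace.exp (x • D))) (L (D * NormedSpace.exp (x • D))) x :=
  hasDerivAt_clm_exp' (LinearMap.toContinuousLinearMap L) D x

theorem hasDerivAt_linear_exp_mul_exp (D D' : Matrix m m ℝ) (x y : ℝ) :
    HasDerivAt (fun y : ℝ => L (NormedSpace.exp ((x - y) • D') * NormedSpace.exp (y • D)))
      (L (NormedSpace.exp ((x - y) • D') * ((D - D') * NormedSpace.exp (y • D)))) y :=
  hasDerivAt_clm_exp_mul_exp (LinearMap.toContinuousLinearMap L) D D' x y

end

variable {n : ℕ}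

/-- The block matrix `[[0, M], [I, 0]]`. -/
def blockMat (M : Matrix (Fin n) (Fin n) ℝ) : Matrix (Fin n ⊕ Fin n) (Fin n ⊕ Fin n) ℝ :=
  Matrix.fromBlocks 0 M 1 0

/-- The number `[K 0] N c`. -/
def rowPair (K : Matrix (Fin 1) (Fin n) ℝ) (c : Fin n ⊕ Fin n → ℝ) :
    Matrix (Fin n ⊕ Fin n) (Fin n ⊕ Fin n) ℝ →ₗ[ℝ] ℝ where
  toFun := fun N => Sum.elim (K 0) 0 ⬝ᵥ (N *ᵥ c)
  map_add' := fun N N' => by rw [Matrix.add_mulVec, dotProduct_add]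
  map_smul' := fun r N => by rw [Matrix.smul_mulVec, dotProduct_smul]; rfl

theorem rowPair_apply (K : Matrix (Fin 1) (Fin n) ℝ) (c : Fin n ⊕ Fin n → ℝ)
    (N : Matrix (Fin n ⊕ Fin n) (Fin n ⊕ Fin n) ℝ) :
    rowPair K c N = Sum.elim (K 0) 0 ⬝ᵥ (N *ᵥ c) := rfl

theorem rowPair_mul (K : Matrix (Fin 1) (Fin n) ℝ) (c : Fin n ⊕ Fin n → ℝ)
    (N N' : Matrix (Fin n ⊕ Fin n) (Fin n ⊕ Fin n) ℝ) :
    rowPair K c (N * N') = rowPair K (N' *ᵥ c) N := by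
  rw [rowPair_apply, rowPair_apply, Matrix.mulVec_mulVec]

/-- The scalar function `[K 0] exp([[0, M], [I, 0]] x) [I; 0] b`. -/
def rowVec (K : Matrix (Fin 1) (Fin n) ℝ) (M : Matrix (Fin n) (Fin n) ℝ) (b : Fin n → ℝ) (x : ℝ) :
    ℝ := rowExp K M x 0 ⬝ᵥ b

theorem rowVec_eq (K : Matrix (Fin 1) (Fin n) ℝ) (M : Matrix (Fin n) (Fin n) ℝ) (b : Fin n → ℝ)
    (x : ℝ) : rowVec K M b x =
      rowPair K (Sum.elim b 0) (NormedSpace.exp (x • blockMat M)) := by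
  rw [rowPair_apply, rowVec, rowExp, blockMat]
  have h : ∀ (N : Matrix (Fin n ⊕ Fin n) (Fin n ⊕ Fin n) ℝ),
      ((Matrix.fromCols K 0 : Matrix (Fin 1) (Fin n ⊕ Fin n) ℝ) * N *
        (Matrix.fromRows 1 0 : Matrix (Fin n ⊕ Fin n) (Fin n) ℝ)) 0 ⬝ᵥ b =
        Sum.elim (K 0) 0 ⬝ᵥ (N *ᵥ Sum.elim b 0) := by
    intro N
    have h1 : ((Matrix.fromCols K 0 : Matrix (Fin 1) (Fin n ⊕ Fin n) ℝ) 0) = Sum.elim (K 0) 0 := by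
      funext i; cases i <;> rfl
    have h2 : (Matrix.fromRows 1 0 : Matrix (Fin n ⊕ Fin n) (Fin n) ℝ) *ᵥ b = Sum.elim b 0 := by
      rw [Matrix.fromRows_mulVec, Matrix.one_mulVec, Matrix.zero_mulVec]
    rw [← h1, ← h2]
    change ((Matrix.fromCols K 0 * N * Matrix.fromRows 1 0) *ᵥ b) 0 =
      ((Matrix.fromCols K 0 : Matrix (Fin 1) (Fin n ⊕ Fin n) ℝ) *ᵥ _) 0
    rw [Matrix.mulVec_mulVec, Matrix.mulVec_mulVec, Matrix.mul_assoc]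
  exact h _

theorem hasDerivAt_rowPair_exp (K : Matrix (Fin 1) (Fin n) ℝ) (M : Matrix (Fin n) (Fin n) ℝ)
    (c : Fin n ⊕ Fin n → ℝ) (x : ℝ) :
    HasDerivAt (fun x => rowPair K c (NormedSpace.exp (x • blockMat M)))
      (rowPair K (blockMat M *ᵥ c) (NormedSpace.exp (x • blockMat M))) x := by
  have h := hasDerivAt_linear_exp (rowPair K c) (blockMat M) x
  rwa [rowPair_mul] at h

theorem blockMat_mulVec_left (M : Matrix (Fin n) (Fin n) ℝ) (b : Fin n → ℝ) :
    blockMat M *ᵥ Sum.elim b 0 = Sum.elim (0 : Fin n → ℝ) b := by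
  rw [blockMat, Matrix.fromBlocks_mulVec]
  simp

theorem blockMat_mulVec_right (M : Matrix (Fin n) (Fin n) ℝ) (b : Fin n → ℝ) :
    blockMat M *ᵥ Sum.elim (0 : Fin n → ℝ) b = Sum.elim (M *ᵥ b) 0 := by
  rw [blockMat, Matrix.fromBlocks_mulVec]
  simp

variable (K : Matrix (Fin 1) (Fin n) ℝ) (M : Matrix (Fin n) (Fin n) ℝ)

theorem hasDerivAt_rowVec (b : Fin n → ℝ) (x : ℝ) : HasDerivAt (rowVec K M b)
    (rowPair K (Sum.elim 0 b) (NormedSpace.exp (x • blockMat M))) x := by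
  have h := hasDerivAt_rowPair_exp K M (Sum.elim b 0) x
  rw [blockMat_mulVec_left] at h
  exact h.congr_of_eventuallyEq (Eventually.of_forall fun x => rowVec_eq K M b x)

theorem continuous_rowVec (b : Fin n → ℝ) : Continuous (rowVec K M b) :=
  continuous_iff_continuousAt.2 fun x => (hasDerivAt_rowVec K M b x).continuousAt

theorem rowVec_zero (b : Fin n → ℝ) : rowVec K M b 0 = K 0 ⬝ᵥ b := by
  rw [rowVec_eq, zero_smul, NormedSpace.exp_zero, rowPair_apply, Matrix.one_mulVec]
  simp

theorem rowVec_eq_add_cconv (b : Fin n → ℝ) (x : ℝ) :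
    rowVec K M b x = K 0 ⬝ᵥ b + cconv (fun x => x) (rowVec K M (M *ᵥ b)) x := by
  rw [← rowVec_zero K M b]
  refine eq_add_cconv_of_hasDerivAt (hasDerivAt_rowVec K M b) (fun x => ?_)
    (continuous_rowVec K M _) ?_ x
  · have h := hasDerivAt_rowPair_exp K M (Sum.elim 0 b) x
    rwa [blockMat_mulVec_right, ← rowVec_eq] at h
  · rw [zero_smul, NormedSpace.exp_zero, rowPair_apply, Matrix.one_mulVec]
    simp

theorem rowVec_add (b b' : Fin n → ℝ) (x : ℝ) :
    rowVec K M (b + b') x = rowVec K M b x + rowVec K M b' x := by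
  rw [rowVec, dotProduct_add]; rfl

theorem rowVec_smul (r : ℝ) (b : Fin n → ℝ) (x : ℝ) :
    rowVec K M (r • b) x = r * rowVec K M b x := by
  rw [rowVec, dotProduct_smul]; rfl

/-- The lower block `[0 K] exp([[0, M], [I, 0]] x) [I; 0] b` is a primitive of the upper one. -/
theorem lower_block_eq_integral (b : Fin n → ℝ) (x : ℝ) :
    K 0 ⬝ᵥ (fun i => (NormedSpace.exp (x • blockMat M) *ᵥ Sum.elim b 0) (Sum.inr i)) =
      ∫ y in (0 : ℝ)..x, rowVec K M b y := by
  let L : Matrix (Fin n ⊕ Fin n) (Fin n ⊕ Fin n) ℝ →ₗ[ℝ] ℝ :=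
    { toFun := fun N => K 0 ⬝ᵥ fun i => (N *ᵥ Sum.elim b 0) (Sum.inr i)
      map_add' := fun N N' => by rw [Matrix.add_mulVec, ← dotProduct_add]; rfl
      map_smul' := fun r N => by rw [Matrix.smul_mulVec, RingHom.id_apply, ← dotProduct_smul]; rfl }
  have hL : ∀ N, L N = K 0 ⬝ᵥ fun i => (N *ᵥ Sum.elim b 0) (Sum.inr i) := fun N => rfl
  have hd : ∀ x, HasDerivAt (fun x => L (NormedSpace.exp (x • blockMat M))) (rowVec K M b x) x := by
    intro x
    refine (hasDerivAt_linear_exp' L (blockMat M) x).congr_deriv ?_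
    rw [hL, rowVec_eq, rowPair_apply, ← Matrix.mulVec_mulVec]
    have : ∀ v : Fin n ⊕ Fin n → ℝ, K 0 ⬝ᵥ (fun i => (blockMat M *ᵥ v) (Sum.inr i)) =
        Sum.elim (K 0) 0 ⬝ᵥ v := by
      intro v
      rw [blockMat, Matrix.fromBlocks_mulVec]
      simp [dotProduct, Fintype.sum_sum_type]
    exact this _
  have := intervalIntegral.integral_eq_sub_of_hasDerivAt (a := 0) (b := x) (fun y _ => hd y)
    ((continuous_rowVec K M b).intervalIntegrable _ _)
  rw [this, zero_smul, NormedSpace.exp_zero, hL, hL, Matrix.one_mulVec]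
  simp only [Sum.elim_inr, Pi.zero_apply]
  rw [show (fun _ : Fin n => (0 : ℝ)) = 0 from rfl, dotProduct_zero, sub_zero]

/-- The resolvent identity of the two families of row vectors. -/
theorem rowVec_resolvent (B : Fin n → ℝ) (M' : Matrix (Fin n) (Fin n) ℝ)
    (hM' : ∀ b, M' *ᵥ b = M *ᵥ b + (K 0 ⬝ᵥ b) • B) (b : Fin n → ℝ) (x : ℝ) :
    rowVec K M' b x = rowVec K M b x +
      cconv (fun x => ∫ y in (0 : ℝ)..x, rowVec K M' B y) (rowVec K M b) x := by
  let p : ℝ → ℝ := fun y => ∫ s in (0 : ℝ)..y, rowVec K M b s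
  have hpc : Continuous p := continuous_iff_continuousAt.2 fun y =>
    (hasDerivAt_integral_of_continuous (continuous_rowVec K M b) y).continuousAt
  have hd : ∀ y, HasDerivAt (fun y => rowPair K (Sum.elim b 0)
      (NormedSpace.exp ((x - y) • blockMat M') * NormedSpace.exp (y • blockMat M)))
      (-(rowVec K M' B (x - y) * p y)) y := by
    intro y
    refine (hasDerivAt_linear_exp_mul_exp (rowPair K (Sum.elim b 0)) (blockMat M) (blockMat M')
      x y).congr_deriv ?_
    rw [rowPair_mul, ← Matrix.mulVec_mulVec, rowVec_eq,
      show p y = _ from (lower_block_eq_integral K M b y).symm]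
    set v := NormedSpace.exp (y • blockMat M) *ᵥ Sum.elim b 0
    -- The generators differ by a rank-one block: the lower component is read off by `K` and sent
    -- along `B`.
    have : (blockMat M - blockMat M') *ᵥ v =
        (-(K 0 ⬝ᵥ fun i => v (Sum.inr i))) • Sum.elim B 0 := by
      rw [Matrix.sub_mulVec, blockMat, blockMat, Matrix.fromBlocks_mulVec, Matrix.fromBlocks_mulVec]
      simp only [hM']
      funext i
      cases i with
      | inl i =>
        simp [Function.comp_def]
      | inr i => simp
    rw [this]
    simp only [rowPair_apply, Matrix.mulVec_smul, dotProduct_smul, smul_eq_mul]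
    ring
  have hψc := continuous_rowVec K M' B
  have h1 := intervalIntegral.integral_eq_sub_of_hasDerivAt (a := 0) (b := x) (fun y _ => hd y)
    (Continuous.intervalIntegrable (by fun_prop) _ _)
  rw [sub_self, zero_smul, NormedSpace.exp_zero, one_mul, sub_zero, zero_smul, NormedSpace.exp_zero,
    mul_one, ← rowVec_eq, ← rowVec_eq, intervalIntegral.integral_neg] at h1
  have hN : ∀ y, HasDerivAt (fun y => ∫ s in (0 : ℝ)..(x - y), rowVec K M' B s)
      (-rowVec K M' B (x - y)) y := by
    intro y
    refine ((hasDerivAt_integral_of_continuous hψc (x - y)).comp y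
      ((hasDerivAt_id y).const_sub x)).congr_deriv ?_
    simp
  -- Duhamel produces `ψB` convolved with a primitive of `γb`. Integration by parts moves the
  -- primitive onto `ψB`, where it becomes the kernel `n`; both boundary terms vanish.
  have h2 := intervalIntegral.integral_mul_deriv_eq_deriv_mul (a := 0) (b := x)
    (fun y _ => hN y) (fun y _ => hasDerivAt_integral_of_continuous (continuous_rowVec K M b) y)
    (Continuous.intervalIntegrable (by fun_prop) _ _)
    ((continuous_rowVec K M b).intervalIntegrable _ _)
  rw [cconv, h2]
  simp only [sub_self, intervalIntegral.integral_same, zero_mul, mul_zero, sub_zero, neg_mul,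
    intervalIntegral.integral_neg, zero_sub]
  linarith [h1]

end RowExp

/-! ### The backstepping transformation -/

theorem le_maxTri {F : ℝ → ℝ → ℝ} (hF : Continuous fun p : ℝ × ℝ => F p.1 p.2) {x y : ℝ}
    (hx : x ∈ Icc (0 : ℝ) 1) (hy : y ∈ Icc 0 x) : |F x y| ≤ maxTri F := by
  obtain ⟨C, _, hC⟩ := exists_kernel_bound hF
  refine le_csSup ⟨C, ?_⟩ ⟨(x, y), ⟨hy.1, hy.2, hx.2⟩, rfl⟩
  rintro _ ⟨p, ⟨h1, h2, h3⟩, rfl⟩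
  exact hC p.1 ⟨h1.trans h2, h3⟩ p.2 ⟨h1, h2⟩

theorem maxTri_nonneg {F : ℝ → ℝ → ℝ} (hF : Continuous fun p : ℝ × ℝ => F p.1 p.2) :
    0 ≤ maxTri F :=
  (abs_nonneg _).trans (le_maxTri hF (x := 0) (y := 0) ⟨le_rfl, zero_le_one⟩ ⟨le_rfl, le_rfl⟩)

theorem le_maxUnit {F : ℝ → ℝ} (hF : Continuous F) {x : ℝ} (hx : x ∈ Icc (0 : ℝ) 1) :
    F x ≤ maxUnit F :=
  le_csSup (isCompact_Icc.bddAbove_image hF.continuousOn) ⟨x, hx, rfl⟩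

theorem abs_dotProduct_le {n : ℕ} (g b : Fin n → ℝ) :
    |g ⬝ᵥ b| ≤ ‖(WithLp.toLp 2 g : E n)‖ * ‖(WithLp.toLp 2 b : E n)‖ := by
  have := abs_real_inner_le_norm (WithLp.toLp 2 g : E n) (WithLp.toLp 2 b)
  rw [EuclideanSpace.inner_eq_star_dotProduct] at this
  simpa [dotProduct_comm] using this

theorem continuous_rowExp {n : ℕ} (K : Matrix (Fin 1) (Fin n) ℝ) (M : Matrix (Fin n) (Fin n) ℝ) :
    Continuous fun x => rowNorm (rowExp K M x) := by
  unfold rowNorm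
  refine continuous_norm.comp ((PiLp.continuous_toLp 2 _).comp (continuous_pi fun i => ?_))
  have h : (fun x => rowExp K M x 0 i) = rowVec K M (Pi.single i 1) := by funext x; simp [rowVec]
  exact h ▸ continuous_rowVec K M (Pi.single i 1)

theorem abs_rowApply_le {n : ℕ} (g : Matrix (Fin 1) (Fin n) ℝ) (X : E n) :
    |rowApply g X| ≤ rowNorm g * ‖X‖ :=
  abs_dotProduct_le (g 0) X.ofLp

/-- The operator `X ↦ [K 0] exp([[0, M], [I, 0]] x) [I; 0] X` from `ℝⁿ` to `L²(0,1)`. -/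
def rowOp {n : ℕ} (K : Matrix (Fin 1) (Fin n) ℝ) (M : Matrix (Fin n) (Fin n) ℝ) :
    E n →L[ℝ] L2 :=
  LinearMap.toContinuousLinearMap
    { toFun := fun X => cls (rowVec K M X.ofLp)
      map_add' := fun X Y => by
        rw [← cls_add (continuous_rowVec K M _).continuousOn (continuous_rowVec K M _).continuousOn]
        congr 1
        exact funext fun x => rowVec_add K M _ _ x
      map_smul' := fun r X => by
        rw [RingHom.id_apply, ← cls_smul _ (continuous_rowVec K M _).continuousOn]
        congr 1
        exact funext fun x => rowVec_smul K M _ _ x }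

theorem rowOp_apply {n : ℕ} (K : Matrix (Fin 1) (Fin n) ℝ) (M : Matrix (Fin n) (Fin n) ℝ) (X : E n) :
    rowOp K M X = cls (rowVec K M X.ofLp) := rfl

theorem rowOp_eq {n : ℕ} (K : Matrix (Fin 1) (Fin n) ℝ) (M : Matrix (Fin n) (Fin n) ℝ) (X : E n) :
    rowOp K M X = rowApply K X • one + dint (rowOp K M (act M X)) := by
  have hc := continuous_rowVec K M (act M X).ofLp
  rw [rowOp_apply, rowOp_apply, dint, conv_cls _ hc, one, ← cls_smul _ continuousOn_const,
    ← cls_add continuousOn_const (continuous_cconv (a := fun x => x) continuous_id hc).continuousOn]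
  congr 1
  funext x
  rw [rowVec_eq_add_cconv, mul_one]
  rfl

namespace Data

variable {n : ℕ} (S : Data n)

/-- The matrix `A - aI`. -/
abbrev Ma : Matrix (Fin n) (Fin n) ℝ := S.A - S.a • 1

/-- The matrix `A + BK - aI`. -/
abbrev Mc : Matrix (Fin n) (Fin n) ℝ := S.A + S.B * S.K - S.a • 1

/-- The vector `B`. -/
def Bvec : E n := WithLp.toLp 2 fun i => S.B i 0

/-- The function `x ↦ k(x,0)`. -/
def kfun (x : ℝ) : ℝ := ∫ y in (0 : ℝ)..x, rowVec S.K S.Ma S.Bvec.ofLp y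

/-- The function `x ↦ n(x,0)`. -/
def nfun (x : ℝ) : ℝ := ∫ y in (0 : ℝ)..x, rowVec S.K S.Mc S.Bvec.ofLp y

theorem kfun_eq : S.kfun = cconv (fun _ => 1) (rowVec S.K S.Ma S.Bvec.ofLp) := by
  funext x; simp [kfun, cconv]

theorem nfun_eq : S.nfun = cconv (fun _ => 1) (rowVec S.K S.Mc S.Bvec.ofLp) := by
  funext x; simp [nfun, cconv]

theorem continuous_kfun : Continuous S.kfun := by
  rw [kfun_eq]; exact continuous_cconv continuous_const (continuous_rowVec _ _ _)

theorem continuous_nfun : Continuous S.nfun := by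
  rw [nfun_eq]; exact continuous_cconv continuous_const (continuous_rowVec _ _ _)

theorem continuous_k : Continuous fun p : ℝ × ℝ => S.k p.1 p.2 :=
  continuous_conv_kernel S.continuous_kfun

theorem continuous_q : Continuous fun p : ℝ × ℝ => S.q p.1 p.2 :=
  continuous_besselKer (S.a + S.c)

theorem l_eq (x y : ℝ) : S.l x y = -besselKer (-(S.a + S.c)) x y := by
  simp only [l, besselKer]
  ring_nf

theorem continuous_l : Continuous fun p : ℝ × ℝ => S.l p.1 p.2 := by
  simp only [l_eq]
  exact (continuous_besselKer _).neg

/-- Convolution by `k`. -/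
def kOp : L2 →L[ℝ] L2 := conv S.kfun S.continuous_kfun

/-- Convolution by `n`. -/
def nOp : L2 →L[ℝ] L2 := conv S.nfun S.continuous_nfun

/-- The operator `X ↦ γ X`. -/
def gammaOp : E n →L[ℝ] L2 := rowOp S.K S.Ma

/-- The operator `X ↦ ψ X`. -/
def psiOp : E n →L[ℝ] L2 := rowOp S.K S.Mc

theorem kOp_eq (w : L2) : S.kOp w = prim (conv _ (continuous_rowVec S.K S.Ma S.Bvec.ofLp) w) := by
  rw [kOp, prim, conv_conv]
  exact conv_congr S.kfun_eq _ _ w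

theorem nOp_eq (w : L2) : S.nOp w = prim (conv _ (continuous_rowVec S.K S.Mc S.Bvec.ofLp) w) := by
  rw [nOp, prim, conv_conv]
  exact conv_congr S.nfun_eq _ _ w

theorem Mc_mulVec (b : Fin n → ℝ) :
    S.Mc.mulVec b = S.Ma.mulVec b + (S.K 0 ⬝ᵥ b) • S.Bvec.ofLp := by
  rw [Mc, add_sub_right_comm, Matrix.add_mulVec, ← Matrix.mulVec_mulVec]
  congr 1
  funext i
  simp [Matrix.mulVec, dotProduct, Bvec, mul_comm]

theorem psi_resolvent (b : Fin n → ℝ) (x : ℝ) :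
    rowVec S.K S.Mc b x = rowVec S.K S.Ma b x + cconv S.nfun (rowVec S.K S.Ma b) x :=
  rowVec_resolvent S.K S.Ma S.Bvec.ofLp S.Mc S.Mc_mulVec b x

theorem psiOp_eq (X : E n) : S.psiOp X = S.gammaOp X + S.nOp (S.gammaOp X) := by
  have hc := continuous_rowVec S.K S.Ma X.ofLp
  rw [psiOp, gammaOp, rowOp_apply, rowOp_apply, nOp, conv_cls _ hc,
    ← cls_add hc.continuousOn (continuous_cconv S.continuous_nfun hc).continuousOn]
  congr 1
  exact funext fun x => S.psi_resolvent _ x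

/-- Equivalent to `(1 + n)(1 - k) = 1` for the convolution operators: the first backstepping step is
inverted by `n`. It is the resolvent identity for `ψB`, integrated once. -/
theorem nOp_resolvent (w : L2) : S.nOp w = S.kOp w + S.nOp (S.kOp w) := by
  have hγ := continuous_rowVec S.K S.Ma S.Bvec.ofLp
  rw [nOp_eq, conv_add_kernel hγ (continuous_cconv S.continuous_nfun hγ) _
    (S.psi_resolvent S.Bvec.ofLp), map_add, ← conv_conv S.continuous_nfun hγ, kOp_eq]
  congr 1
  exact conv_comm _ _ _

/-- The first backstepping transformation `w = u - k * u - γ X`. -/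
def bw (X : E n) (u : L2) : L2 := u - S.kOp u - S.gammaOp X

/-- Both sides are `u - w`, written in the original and in the transformed variable. -/
theorem kOp_add_gammaOp (X : E n) (u : L2) :
    S.kOp u + S.gammaOp X = S.nOp (S.bw X u) + S.psiOp X := by
  rw [bw, map_sub, map_sub, psiOp_eq, S.nOp_resolvent u]
  abel

theorem kOp_one : S.kOp one = dint (S.gammaOp S.Bvec) := by
  have hγ := continuous_rowVec S.K S.Ma S.Bvec.ofLp
  have hp : prim (cls (rowVec S.K S.Ma S.Bvec.ofLp)) =
      cls (cconv (fun _ => 1) (rowVec S.K S.Ma S.Bvec.ofLp)) := conv_cls _ hγ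
  rw [kOp_eq, one, conv_cls _ continuous_const, dint_eq_prim_prim, gammaOp, rowOp_apply, hp, cconv_comm]

theorem kOp_dint (g : L2) : S.kOp (dint g) = dint (S.kOp g) := conv_comm _ _ g

/-- In differential form, `w(0) = u(0) - KX`, and `w'' + aw` is the transform of `(AX + u(0)B, u'' +
au)`. It rests on `γ'' = γ(A - aI)` and `(k * u)'' = k * u'' + u(0)γB`. -/
theorem bw_affine (X : E n) (f₀ : ℝ) (g : L2) :
    S.bw X (f₀ • one + dint g) = (f₀ - rowApply S.K X) • one +
      dint (S.bw (act S.A X + f₀ • S.Bvec) (g + S.a • (f₀ • one + dint g)) -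
        S.a • S.bw X (f₀ • one + dint g)) := by
  have hM : S.gammaOp (act S.Ma X) = S.gammaOp (act S.A X) - S.a • S.gammaOp X := by
    rw [← map_smul, ← map_sub]
    congr 1
    ext i
    simp [act, Matrix.sub_mulVec, Matrix.smul_mulVec]
  have hγ : S.gammaOp X = rowApply S.K X • one + dint (S.gammaOp (act S.Ma X)) := rowOp_eq _ _ X
  have e : S.bw (act S.A X + f₀ • S.Bvec) (g + S.a • (f₀ • one + dint g)) -
        S.a • S.bw X (f₀ • one + dint g) =
      g - S.kOp g - f₀ • S.gammaOp S.Bvec - S.gammaOp (act S.Ma X) := by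
    rw [hM]
    simp only [bw, map_add, map_smul, smul_sub, smul_add]
    abel
  rw [e]
  conv_lhs => rw [bw, hγ, map_add, map_smul, kOp_one, kOp_dint]
  simp only [map_sub, map_smul, sub_smul]
  abel

/-- The full transformation to the target variable `z`. -/
def zmap (X : E n) (u : L2) : L2 := besselT (S.a + S.c) (S.bw X u)

/-- The shift `κ = a + c` converts the reaction term `aw` into the damping `-cz`, while `z(0) =
w(0)`. -/
theorem zmap_affine (X : E n) (f₀ : ℝ) (g : L2) :
    ∃ gz : L2, S.zmap X (f₀ • one + dint g) = (f₀ - rowApply S.K X) • one + dint gz ∧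
      S.zmap (act S.A X + f₀ • S.Bvec) (g + S.a • (f₀ • one + dint g)) =
        gz - S.c • S.zmap X (f₀ • one + dint g) := by
  set ω := S.bw (act S.A X + f₀ • S.Bvec) (g + S.a • (f₀ • one + dint g)) with hω
  set w := S.bw X (f₀ • one + dint g) with hw
  have h := S.bw_affine X f₀ g
  rw [← hω, ← hw] at h
  refine ⟨besselT (S.a + S.c) (ω - S.a • w + (S.a + S.c) • w), ?_, ?_⟩
  · rw [zmap, ← hw]
    conv_lhs => rw [h]
    rw [besselT_affine, ← h]
  · rw [zmap, zmap, ← hω, ← hw, ← map_smul, ← map_sub]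
    congr 1
    rw [add_smul]
    abel

theorem zmap_add (X Y : E n) (u v : L2) : S.zmap (X + Y) (u + v) = S.zmap X u + S.zmap Y v := by
  simp only [zmap, ← map_add]
  congr 1
  simp only [bw, map_add]; abel

theorem bw_eq_zmap_sub (X : E n) (u : L2) :
    S.bw X u = S.zmap X u - besselOp (-(S.a + S.c)) (S.zmap X u) := by
  conv_lhs => rw [← besselT_neg_besselT (S.a + S.c) (S.bw X u)]
  rfl

/-- Both sides are `w - z`. It replaces the `q`-integral of `w` in the feedback by the `l`-integral
of `z`. -/
theorem besselOp_bw (X : E n) (u : L2) :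
    besselOp (S.a + S.c) (S.bw X u) = -besselOp (-(S.a + S.c)) (S.zmap X u) := by
  have h1 := S.bw_eq_zmap_sub X u
  have h2 : S.zmap X u = S.bw X u - besselOp (S.a + S.c) (S.bw X u) := rfl
  rw [sub_eq_add_neg] at h1
  rw [eq_sub_iff_add_eq] at h2
  exact (add_left_cancel (h1.symm.trans h2.symm)).symm

/-! ### The feedback in the target variables -/

theorem kOp_ae (w : L2) : S.kOp w =ᵐ[μ₀₁] voltFun S.k w := conv_ae _ w

theorem nOp_ae (w : L2) : S.nOp w =ᵐ[μ₀₁] voltFun S.nker w := conv_ae _ w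

theorem continuous_nker : Continuous fun p : ℝ × ℝ => S.nker p.1 p.2 :=
  continuous_conv_kernel S.continuous_nfun

theorem gammaOp_ae (X : E n) : S.gammaOp X =ᵐ[μ₀₁] fun x => rowApply (S.gamma x) X :=
  cls_ae (continuous_rowVec S.K S.Ma X.ofLp).continuousOn

theorem psiOp_ae (X : E n) : S.psiOp X =ᵐ[μ₀₁] fun x => rowApply (S.psi x) X :=
  cls_ae (continuous_rowVec S.K S.Mc X.ofLp).continuousOn

theorem continuous_rowApply_gamma (X : E n) : Continuous fun x => rowApply (S.gamma x) X :=
  continuous_rowVec S.K S.Ma X.ofLp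

theorem continuous_rowApply_psi (X : E n) : Continuous fun x => rowApply (S.psi x) X :=
  continuous_rowVec S.K S.Mc X.ofLp

theorem bw_ae (X : E n) (u : L2) :
    S.bw X u =ᵐ[μ₀₁] fun y => u y - voltFun S.k u y - rowApply (S.gamma y) X := by
  filter_upwards [Lp.coeFn_sub (u - S.kOp u) (S.gammaOp X), Lp.coeFn_sub u (S.kOp u),
    S.kOp_ae u, S.gammaOp_ae X] with x h1 h2 h3 h4
  rw [bw, h1, Pi.sub_apply, h2, Pi.sub_apply, h3, h4]

theorem feedback_eq (X : E n) (u : L2) :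
    S.feedback X u = voltFun S.k u 1 + rowApply (S.gamma 1) X +
      voltFun (besselKer (S.a + S.c)) (S.bw X u) 1 := by
  rw [voltFun_congr (S.bw_ae X u) ⟨zero_le_one, le_rfl⟩]
  rfl

/-- The boundary condition `u(1) = U(X,u)` means `z(1) = 0`. -/
theorem zmap_boundary {X : E n} {u g : L2} {f f' : ℝ → ℝ} (hu : IsH2 u f f' g) (h0 : f' 0 = 0)
    (h1 : f 1 = S.feedback X u) {z₀ : ℝ} {gz : L2} (hz : S.zmap X u = z₀ • one + dint gz) :
    z₀ + ∫ y in (0 : ℝ)..1, (1 - y) * gz y = 0 := by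
  let F : ℝ → ℝ := fun x => f x - voltFun S.k u x - rowApply (S.gamma x) X -
    voltFun (besselKer (S.a + S.c)) (S.bw X u) x
  have hF : ContinuousOn F (Icc 0 1) :=
    (((hu.continuousOn h0).sub (voltFun_continuousOn S.continuous_k (integrable_coe u))).sub
      (S.continuous_rowApply_gamma X).continuousOn).sub
      (voltFun_continuousOn (continuous_besselKer _) (integrable_coe _))
  have hae : (fun x => z₀ + ∫ y in (0 : ℝ)..x, (x - y) * gz y) =ᵐ[μ₀₁] F := by
    refine (affine_dint_ae z₀ gz).symm.trans ?_
    rw [← hz, zmap, besselT_apply]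
    filter_upwards [Lp.coeFn_sub (S.bw X u) (besselOp (S.a + S.c) (S.bw X u)), S.bw_ae X u,
      volt_ae (continuous_besselKer (S.a + S.c)) (S.bw X u), hu.ae_eq] with x h1 h2 h3 h4
    rw [h1, Pi.sub_apply, besselOp, h3, h2, h4]
  -- Two continuous representatives of `z` agree up to the endpoint `x = 1`, where one of them is
  -- `u(1) - U`.
  have := eqOn_of_ae_unit hae (continuousOn_const.add (continuousOn_dint gz)) hF
    (right_mem_Icc.2 zero_le_one)
  simp only at this
  rw [this]
  simp only [F]
  rw [h1, feedback_eq]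
  ring

/-- The `L²` identities `kOp_add_gammaOp` and `besselOp_bw` hold pointwise for continuous
representatives, and are read at `x = 1`. -/
theorem feedback_eq_target (X : E n) (u : L2) :
    S.feedback X u = rowApply (S.psi 1) X + voltFun S.nker (S.bw X u) 1 +
      voltFun S.l (S.zmap X u) 1 := by
  have h1 : EqOn (fun x => voltFun S.k u x + rowApply (S.gamma x) X)
      (fun x => voltFun S.nker (S.bw X u) x + rowApply (S.psi x) X) (Icc 0 1) := by
    refine eqOn_of_ae_unit ?_
      ((voltFun_continuousOn S.continuous_k (integrable_coe u)).add
        (S.continuous_rowApply_gamma X).continuousOn)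
      ((voltFun_continuousOn S.continuous_nker (integrable_coe _)).add
        (S.continuous_rowApply_psi X).continuousOn)
    have h := S.kOp_add_gammaOp X u
    filter_upwards [Lp.coeFn_add (S.kOp u) (S.gammaOp X), Lp.coeFn_add (S.nOp (S.bw X u)) (S.psiOp X),
      S.kOp_ae u, S.gammaOp_ae X, S.nOp_ae (S.bw X u), S.psiOp_ae X] with x e1 e2 e3 e4 e5 e6
    rw [← e3, ← e4, ← e5, ← e6, ← Pi.add_apply, ← e1, ← Pi.add_apply, ← e2, h]
  have h2 : EqOn (voltFun (besselKer (S.a + S.c)) (S.bw X u)) (voltFun S.l (S.zmap X u))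
      (Icc 0 1) := by
    refine eqOn_of_ae_unit ?_ (voltFun_continuousOn (continuous_besselKer _) (integrable_coe _))
      (voltFun_continuousOn S.continuous_l (integrable_coe _))
    filter_upwards [volt_ae (continuous_besselKer (S.a + S.c)) (S.bw X u),
      volt_ae (continuous_besselKer (-(S.a + S.c))) (S.zmap X u),
      Lp.coeFn_neg (besselOp (-(S.a + S.c)) (S.zmap X u))] with x e1 e2 e3
    rw [← e1]
    have := S.besselOp_bw X u
    rw [besselOp] at this
    rw [this, e3, Pi.neg_apply, besselOp, e2]
    simp only [voltFun, l_eq, neg_mul, intervalIntegral.integral_neg]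
  have e1 := h1 (right_mem_Icc.2 zero_le_one)
  have e2 := h2 (right_mem_Icc.2 zero_le_one)
  simp only at e1
  rw [feedback_eq, e1, e2]
  ring

/-! ### Norm bounds -/

theorem norm_kOp_le (u : L2) : ‖S.kOp u‖ ≤ maxTri S.k * ‖u‖ :=
  norm_volt_le S.continuous_k (fun _ hx _ hy => le_maxTri S.continuous_k hx hy) u

theorem norm_besselOp_le (w : L2) : ‖besselOp (S.a + S.c) w‖ ≤ S.qMax * ‖w‖ :=
  norm_volt_le (continuous_besselKer _) (fun _ hx _ hy => le_maxTri S.continuous_q hx hy) w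

theorem norm_besselOp_neg_le (z : L2) : ‖besselOp (-(S.a + S.c)) z‖ ≤ maxTri S.l * ‖z‖ := by
  refine norm_volt_le _ (fun x hx y hy => ?_) z
  rw [← abs_neg, ← l_eq]
  exact le_maxTri S.continuous_l hx hy

theorem rowNorm_gamma_le {x : ℝ} (hx : x ∈ Icc (0 : ℝ) 1) : rowNorm (S.gamma x) ≤ S.gammaMax :=
  le_maxUnit (F := fun x => rowNorm (S.gamma x)) (continuous_rowExp S.K S.Ma) hx

theorem gammaMax_nonneg : 0 ≤ S.gammaMax :=
  (norm_nonneg _).trans (S.rowNorm_gamma_le (left_mem_Icc.2 zero_le_one))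

theorem qMax_nonneg : 0 ≤ S.qMax := maxTri_nonneg S.continuous_q

theorem norm_gammaOp_le (X : E n) : ‖S.gammaOp X‖ ≤ S.gammaMax * ‖X‖ := by
  refine norm_cls_le (continuous_rowVec S.K S.Ma X.ofLp).continuousOn
    (mul_nonneg S.gammaMax_nonneg (norm_nonneg _)) fun x hx => ?_
  exact (abs_rowApply_le (S.gamma x) X).trans
    (mul_le_mul_of_nonneg_right (S.rowNorm_gamma_le hx) (norm_nonneg _))

theorem norm_besselT_le (w : L2) : ‖besselT (S.a + S.c) w‖ ≤ (1 + S.qMax) * ‖w‖ := by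
  rw [besselT_apply, add_mul, one_mul]
  exact (norm_sub_le _ _).trans (add_le_add_right (S.norm_besselOp_le w) _)

theorem norm_bw_le (X : E n) (u : L2) :
    ‖S.bw X u‖ ≤ (1 + maxTri S.k) * ‖u‖ + S.gammaMax * ‖X‖ := by
  have h1 := norm_sub_le (u - S.kOp u) (S.gammaOp X)
  have h2 := norm_sub_le u (S.kOp u)
  have h3 := S.norm_kOp_le u
  have h4 := S.norm_gammaOp_le X
  rw [bw]
  linarith

theorem norm_bw_le_zmap (X : E n) (u : L2) : ‖S.bw X u‖ ≤ (1 + maxTri S.l) * ‖S.zmap X u‖ := by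
  rw [bw_eq_zmap_sub, add_mul, one_mul]
  exact (norm_sub_le _ _).trans (add_le_add_right (S.norm_besselOp_neg_le _) _)

/-- The factors `2` in `M₁` and `M₂` come from `(s + t)² ≤ 2s² + 2t²`. -/
theorem norm_zmap_sq_le (X : E n) (u : L2) :
    ‖X‖ ^ 2 + ‖S.zmap X u‖ ^ 2 ≤ S.M1 * ‖X‖ ^ 2 + S.M2 * ‖u‖ ^ 2 := by
  have h1 : ‖S.zmap X u‖ ≤ (1 + S.qMax) * ((1 + maxTri S.k) * ‖u‖ + S.gammaMax * ‖X‖) :=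
    (S.norm_besselT_le _).trans
      (mul_le_mul_of_nonneg_left (S.norm_bw_le X u) (by linarith [S.qMax_nonneg]))
  have h2 := pow_le_pow_left₀ (norm_nonneg _) h1 2
  rw [M1, M2]
  nlinarith [sq_nonneg ((1 + S.qMax) * ((1 + maxTri S.k) * ‖u‖ - S.gammaMax * ‖X‖))]

theorem norm_zmap_gamma_sq_le (Y : E n) :
    ‖besselT (S.a + S.c) (S.gammaOp Y)‖ ^ 2 ≤ S.zeta * ‖Y‖ ^ 2 := by
  have h1 : ‖besselT (S.a + S.c) (S.gammaOp Y)‖ ≤ (1 + S.qMax) * (S.gammaMax * ‖Y‖) :=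
    (S.norm_besselT_le _).trans
      (mul_le_mul_of_nonneg_left (S.norm_gammaOp_le Y) (by linarith [S.qMax_nonneg]))
  have h2 := pow_le_pow_left₀ (norm_nonneg _) h1 2
  rw [zeta]
  nlinarith

theorem abs_feedback_le (X : E n) (u : L2) :
    |S.feedback X u| ≤ S.c1 * ‖X‖ + S.c2 * ‖S.zmap X u‖ := by
  have hn : Continuous fun y => |S.nker 1 y| :=
    (S.continuous_nker.comp (by fun_prop : Continuous fun y : ℝ => ((1 : ℝ), y))).abs
  have hl : Continuous fun y => |S.l 1 y| :=
    (S.continuous_l.comp (by fun_prop : Continuous fun y : ℝ => ((1 : ℝ), y))).abs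
  have h1 : |rowApply (S.psi 1) X| ≤ S.c1 * ‖X‖ := abs_rowApply_le _ X
  have h2 : |voltFun S.nker (S.bw X u) 1| ≤ (maxUnit fun y => |S.nker 1 y|) * ‖S.bw X u‖ :=
    abs_integral_mul_le _ (right_mem_Icc.2 zero_le_one) fun y hy => le_maxUnit hn hy
  have h3 : |voltFun S.l (S.zmap X u) 1| ≤ (maxUnit fun y => |S.l 1 y|) * ‖S.zmap X u‖ :=
    abs_integral_mul_le _ (right_mem_Icc.2 zero_le_one) fun y hy => le_maxUnit hl hy
  have h4 : 0 ≤ maxUnit fun y => |S.nker 1 y| :=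
    (abs_nonneg _).trans (le_maxUnit hn (left_mem_Icc.2 zero_le_one))
  have h5 := mul_le_mul_of_nonneg_left (S.norm_bw_le_zmap X u) h4
  rw [feedback_eq_target, c2]
  refine (abs_add_three _ _ _).trans ?_
  nlinarith

/-- The transformation to the target variable is boundedly invertible. -/
theorem exists_norm_le_zmap : ∃ C : ℝ, ∀ (X : E n) (u : L2), ‖u‖ ≤ C * (‖X‖ + ‖S.zmap X u‖) := by
  have hl := maxTri_nonneg S.continuous_l
  refine ⟨(1 + ‖S.nOp‖) * (1 + maxTri S.l) + ‖S.psiOp‖, fun X u => ?_⟩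
  have h : u = S.bw X u + (S.nOp (S.bw X u) + S.psiOp X) := by
    rw [← kOp_add_gammaOp, bw]; abel
  have h1 : ‖u‖ ≤ ‖S.bw X u‖ + (‖S.nOp‖ * ‖S.bw X u‖ + ‖S.psiOp‖ * ‖X‖) := by
    conv_lhs => rw [h]
    refine (norm_add_le _ _).trans (add_le_add_right ((norm_add_le _ _).trans ?_) _)
    exact add_le_add (S.nOp.le_opNorm _) (S.psiOp.le_opNorm _)
  have h2 := S.norm_bw_le_zmap X u
  have h3 : (1 + ‖S.nOp‖) * ‖S.bw X u‖ ≤ (1 + ‖S.nOp‖) * ((1 + maxTri S.l) * ‖S.zmap X u‖) :=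
    mul_le_mul_of_nonneg_left h2 (by positivity)
  have h4 : 0 ≤ (1 + ‖S.nOp‖) * (1 + maxTri S.l) * ‖X‖ := by positivity
  have h5 : 0 ≤ ‖S.psiOp‖ * ‖S.zmap X u‖ := by positivity
  linarith

end Data

open scoped Matrix

/-! ### Quadratic forms -/

/-- The minimum on the compact unit sphere is positive; homogeneity extends the bound to all
vectors. -/
theorem exists_posDef_bound {ι : Type*} [Fintype ι] {M : Matrix ι ι ℝ} (hM : M.PosDef) :
    ∃ ε > 0, ∀ v : ι → ℝ, ε * (v ⬝ᵥ v) ≤ v ⬝ᵥ (M *ᵥ v) := by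
  classical
  rcases isEmpty_or_nonempty ι with hι | hι
  · exact ⟨1, one_pos, fun v => by simp [dotProduct]⟩
  have hne : (Metric.sphere (0 : EuclideanSpace ℝ ι) 1).Nonempty :=
    NormedSpace.sphere_nonempty.2 zero_le_one
  have hc : Continuous fun v : EuclideanSpace ℝ ι => v.ofLp ⬝ᵥ (M *ᵥ v.ofLp) := by
    simp only [dotProduct, Matrix.mulVec]
    fun_prop
  obtain ⟨v₀, hv₀, hmin⟩ := (isCompact_sphere (0 : EuclideanSpace ℝ ι) 1).exists_isMinOn hne
    hc.continuousOn
  have hn : ∀ v : EuclideanSpace ℝ ι, ‖v‖ ^ 2 = v.ofLp ⬝ᵥ v.ofLp := fun v => by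
    rw [← real_inner_self_eq_norm_sq, EuclideanSpace.inner_eq_star_dotProduct]; rfl
  have hv₀' : v₀.ofLp ≠ 0 := by
    intro h
    have := hn v₀
    rw [h, mem_sphere_zero_iff_norm.1 hv₀] at this
    simp at this
  refine ⟨v₀.ofLp ⬝ᵥ (M *ᵥ v₀.ofLp), by simpa using hM.dotProduct_mulVec_pos hv₀', fun v => ?_⟩
  rcases eq_or_ne v 0 with rfl | hv
  · simp
  · let w : EuclideanSpace ℝ ι := WithLp.toLp 2 v
    have hw : w ≠ 0 := fun h => hv (by simpa [w] using h)
    have hw' : 0 < ‖w‖ := norm_pos_iff.2 hw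
    have hs : (‖w‖⁻¹ • w) ∈ Metric.sphere (0 : EuclideanSpace ℝ ι) 1 := by
      rw [mem_sphere_zero_iff_norm, norm_smul, norm_inv, norm_norm, inv_mul_cancel₀ hw'.ne']
    have h1 := hmin hs
    simp only [mem_ofPred_eq, WithLp.ofLp_smul, Matrix.mulVec_smul, dotProduct_smul, smul_dotProduct,
      smul_eq_mul] at h1
    have h2 : v ⬝ᵥ v = ‖w‖ ^ 2 := (hn w).symm
    rw [h2]
    calc _ ≤ (‖w‖⁻¹ * (‖w‖⁻¹ * (w.ofLp ⬝ᵥ (M *ᵥ w.ofLp)))) * ‖w‖ ^ 2 :=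
          mul_le_mul_of_nonneg_right h1 (sq_nonneg _)
      _ = _ := by field_simp; rfl

/-- Multiplication by a matrix as a continuous linear map. -/
def actL {n : ℕ} (M : Matrix (Fin n) (Fin n) ℝ) : E n →L[ℝ] E n :=
  LinearMap.toContinuousLinearMap
    { toFun := act M
      map_add' := fun X Y => by rw [act, WithLp.ofLp_add, Matrix.mulVec_add]; rfl
      map_smul' := fun r X => by rw [act, WithLp.ofLp_smul, Matrix.mulVec_smul]; rfl }

theorem actL_apply {n : ℕ} (M : Matrix (Fin n) (Fin n) ℝ) (X : E n) : actL M X = act M X := rfl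

theorem inner_eq_dotProduct {n : ℕ} (X Y : E n) : ⟪X, Y⟫_ℝ = X.ofLp ⬝ᵥ Y.ofLp := by
  rw [EuclideanSpace.inner_eq_star_dotProduct, dotProduct_comm]; rfl

theorem norm_sq_eq_dotProduct {n : ℕ} (X : E n) : ‖X‖ ^ 2 = X.ofLp ⬝ᵥ X.ofLp := by
  rw [← real_inner_self_eq_norm_sq, inner_eq_dotProduct]

theorem inner_act_comm {n : ℕ} {P : Matrix (Fin n) (Fin n) ℝ} (hP : P.IsHermitian) (X Y : E n) :
    ⟪X, act P Y⟫_ℝ = ⟪Y, act P X⟫_ℝ := by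
  have hT : Pᵀ = P := by simpa [Matrix.IsHermitian] using hP
  rw [inner_eq_dotProduct, inner_eq_dotProduct]
  change X.ofLp ⬝ᵥ (P *ᵥ Y.ofLp) = Y.ofLp ⬝ᵥ (P *ᵥ X.ofLp)
  rw [Matrix.dotProduct_mulVec, ← Matrix.mulVec_transpose, hT, dotProduct_comm]

/-- The quadratic form of a positive definite `2 × 2` matrix evaluated at vectors of a Hilbert
space. -/
theorem exists_posDef_two_bound {a b d : ℝ} (h : (-(!![a, b; b, d] : Matrix (Fin 2) (Fin 2) ℝ)).PosDef) :
    ∃ ε > 0, ∀ z w : L2, a * ‖z‖ ^ 2 + 2 * b * ⟪z, w⟫_ℝ + d * ‖w‖ ^ 2 ≤ -ε * ‖z‖ ^ 2 := by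
  obtain ⟨ε, hε, H⟩ := exists_posDef_bound h
  refine ⟨ε, hε, fun z w => ?_⟩
  have h1 := H ![‖z‖, ‖w‖]
  have h2 := H ![‖z‖, -‖w‖]
  simp [Matrix.mulVec, dotProduct, Fin.sum_univ_two] at h1 h2
  have h3 := abs_le.1 (abs_real_inner_le_norm z w)
  have h4 : 0 ≤ ε * ‖w‖ ^ 2 := by positivity
  -- By Cauchy–Schwarz the cross term is worst at `⟪z, w⟫ = ±‖z‖‖w‖`, with the sign of `b`; this
  -- selects the test vector.
  rcases le_total 0 b with hb | hb
  · have := mul_le_mul_of_nonneg_left h3.2 hb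
    nlinarith
  · have := mul_le_mul_of_nonpos_left h3.1 hb
    nlinarith

/-! ### A comparison principle -/

/-- At the infimum `t₀` of the violation times, continuity gives `V ≤ b` up to `t₀`. If the curves
touch there, the strict slope inequality keeps `V` below `b` just afterwards; otherwise continuity
does. Either way `t₀` is not the infimum. The hypothesis `step` may use the whole past, which is
what both the delay and the saturation require. -/
theorem le_of_crossing {h : ℝ} {V b b' : ℝ → ℝ} (hV : ContinuousOn V (Ici 0))
    (hb : ∀ t, HasDerivAt b (b' t) t) (hinit : ∀ s ∈ Icc (-h) 0, V s ≤ b s)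
    (h0 : V 0 ≤ b 0)
    (step : ∀ t, 0 ≤ t → (∀ s ∈ Icc (-h) t, V s ≤ b s) → V t = b t →
      ∃ d, HasDerivWithinAt V d (Ici 0) t ∧ d < b' t) {t : ℝ} (ht : 0 ≤ t) : V t ≤ b t := by
  by_contra! hlt
  let A : Set ℝ := {t | 0 ≤ t ∧ b t < V t}
  have hA : A.Nonempty := ⟨t, ht, hlt⟩
  have hAb : BddBelow A := ⟨0, fun s hs => hs.1⟩
  set t₀ := sInf A with ht₀
  have ht₀0 : 0 ≤ t₀ := le_csInf hA fun s hs => hs.1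
  have hbc : Continuous b := continuous_iff_continuousAt.2 fun x => (hb x).continuousAt
  have hfc : ContinuousWithinAt (fun s => V s - b s) (Ici 0) t₀ :=
    (hV t₀ ht₀0).sub hbc.continuousWithinAt
  have hbelow : ∀ s, 0 ≤ s → s < t₀ → V s ≤ b s := fun s hs hst => by
    by_contra! hh
    exact absurd (csInf_le hAb (show s ∈ A from ⟨hs, hh⟩)) (not_le.2 hst)
  have hat : V t₀ ≤ b t₀ := by
    rcases ht₀0.eq_or_lt with he | hpos
    · rw [← he]; exact h0
    · have hne : (𝓝[Ico 0 t₀] t₀).NeBot := by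
        rw [← mem_closure_iff_nhdsWithin_neBot, closure_Ico hpos.ne]
        exact ⟨hpos.le, le_rfl⟩
      have h2 : Tendsto (fun s => V s - b s) (𝓝[Ico 0 t₀] t₀) (𝓝 (V t₀ - b t₀)) :=
        hfc.mono Ico_subset_Ici_self
      have := le_of_tendsto h2 (eventually_mem_nhdsWithin.mono fun s hs =>
        sub_nonpos.2 (hbelow s hs.1 hs.2))
      linarith
  have hall : ∀ s ∈ Icc (-h) t₀, V s ≤ b s := by
    intro s hs
    rcases le_total s 0 with h1 | h1
    · exact hinit s ⟨hs.1, h1⟩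
    · rcases hs.2.eq_or_lt with h2 | h2
      · rw [h2]; exact hat
      · exact hbelow s h1 h2
  have hright : ∀ᶠ s in 𝓝[>] t₀, V s ≤ b s := by
    have hsub : Ioi t₀ ⊆ Ici 0 := fun s hs => ht₀0.trans (le_of_lt hs)
    rcases hat.eq_or_lt with he | hlt'
    · obtain ⟨d, hd, hdb⟩ := step t₀ ht₀0 hall he
      have h1 : HasDerivWithinAt (fun s => V s - b s) (d - b' t₀) (Ioi t₀) t₀ :=
        (hd.mono hsub).sub (hb t₀).hasDerivWithinAt
      have h2 := (hasDerivWithinAt_iff_tendsto_slope' (lt_irrefl t₀)).1 h1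
      have h3 := h2.eventually (gt_mem_nhds (show d - b' t₀ < 0 by linarith))
      filter_upwards [h3, self_mem_nhdsWithin] with s hs hs'
      rw [slope_def_field, he, sub_self, sub_zero] at hs
      have : 0 < s - t₀ := sub_pos.2 hs'
      have := (div_neg_iff.1 hs).resolve_left (by rintro ⟨_, h⟩; linarith)
      linarith [this.1]
    · have h2 : Tendsto (fun s => V s - b s) (𝓝[>] t₀) (𝓝 (V t₀ - b t₀)) := hfc.mono hsub
      filter_upwards [h2.eventually (gt_mem_nhds (show V t₀ - b t₀ < 0 by linarith))] with s hs
      linarith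
  obtain ⟨c, hc, hcs⟩ := mem_nhdsGT_iff_exists_Ioo_subset.1 hright
  obtain ⟨s, hsA, hsc⟩ := exists_lt_of_csInf_lt hA (show sInf A < c from hc)
  have hs0 : t₀ ≤ s := csInf_le hAb hsA
  rcases hs0.eq_or_lt with he | hlt'
  · rw [← he] at hsA; exact absurd hsA.2 (not_lt.2 hat)
  · exact absurd hsA.2 (not_lt.2 (hcs ⟨hlt', hsc⟩))

theorem sat_eq_self {U ubar : ℝ} (h : |U| ≤ ubar) : sat U ubar = U := by
  rw [sat, min_eq_left h]
  rcases lt_trichotomy U 0 with h | h | h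
  · rw [Real.sign_of_neg h, abs_of_neg h]; ring
  · simp [h]
  · rw [Real.sign_of_pos h, abs_of_pos h]; ring

namespace Data

variable {n : ℕ} (S : Data n)

/-! ### The Lyapunov functional -/

/-- The form collects the `X`-part of the dissipation with `X' = (A+BK)X + A₁Y + Bz₀`, together with
the Young bound for the mismatched delay; `-lam z₀²` is to be paid for by `‖z'‖²`. -/
theorem theta1_form (P : Matrix (Fin n) (Fin n) ℝ) (hP : P.IsHermitian) (p₁ lam r δ₀ δ₁ : ℝ)
    (X Y : E n) (z₀ : ℝ) :
    Sum.elim (Sum.elim X.ofLp Y.ofLp) (fun _ => z₀) ⬝ᵥ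
      (S.Theta1 P p₁ lam r δ₀ δ₁ *ᵥ Sum.elim (Sum.elim X.ofLp Y.ofLp) (fun _ => z₀)) =
    2 * ⟪X, act P (act S.A X + rowApply S.K X • S.Bvec + act S.A₁ Y + z₀ • S.Bvec)⟫_ℝ +
      2 * δ₀ * ⟪X, act P X⟫_ℝ - 2 * δ₁ * ⟪Y, act P Y⟫_ℝ - lam * z₀ ^ 2 +
      p₁ * r⁻¹ * (S.zeta * ‖act (S.A₁ - S.a₂ • 1) Y‖ ^ 2) := by
  have hT : Pᵀ = P := by simpa [Matrix.IsHermitian] using hP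
  have hPX : ∀ v : Fin n → ℝ, X.ofLp ⬝ᵥ (P *ᵥ v) = v ⬝ᵥ (P *ᵥ X.ofLp) := fun v =>
    (inner_eq_dotProduct X _).symm.trans ((inner_act_comm hP X (WithLp.toLp 2 v)).trans
      (inner_eq_dotProduct (WithLp.toLp 2 v) _))
  have hB : ∀ (z : Fin 1 → ℝ), S.B *ᵥ z = z 0 • S.Bvec.ofLp := by
    intro z; funext i; simp [Matrix.mulVec, dotProduct, Bvec, mul_comm]
  have hK : S.K *ᵥ X.ofLp = fun _ => rowApply S.K X := by
    funext i; rw [Subsingleton.elim i 0]; rfl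
  rw [norm_sq_eq_dotProduct]
  simp only [inner_eq_dotProduct, act, WithLp.ofLp_add, WithLp.ofLp_smul]
  simp only [Theta1, Xi, R, theta11, Matrix.add_mulVec, Matrix.smul_mulVec, Matrix.fromBlocks_mulVec,
    Matrix.fromRows_mulVec, Matrix.fromCols_mulVec, Matrix.zero_mulVec, sumElim_dotProduct_sumElim,
    dotProduct_add, dotProduct_smul, Sum.elim_comp_inl, Sum.elim_comp_inr,
    Matrix.transpose_mul, Matrix.transpose_add, ← Matrix.mulVec_mulVec, hT, Matrix.mulVec_add,
    Matrix.mulVec_smul]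
  have htr : ∀ {k l : ℕ} (N : Matrix (Fin k) (Fin l) ℝ) (v : Fin l → ℝ) (w : Fin k → ℝ),
      v ⬝ᵥ (Nᵀ *ᵥ w) = (N *ᵥ v) ⬝ᵥ w := by
    intro k l N v w
    rw [Matrix.dotProduct_mulVec, Matrix.vecMul_transpose]
  have h1 : (fun _ : Fin 1 => z₀) ⬝ᵥ (1 *ᵥ fun _ : Fin 1 => z₀) = z₀ ^ 2 := by
    simp [dotProduct, sq]
  simp only [htr, h1, hK, hB, dotProduct_zero, Matrix.mulVec_smul, dotProduct_smul, smul_dotProduct,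
    smul_eq_mul]
  rw [hPX (S.A *ᵥ X.ofLp), hPX S.Bvec.ofLp, hPX (S.A₁ *ᵥ Y.ofLp)]
  ring

/-- The Lyapunov functional `XᵀPX + p₁‖z‖²`. -/
def lyap (P : Matrix (Fin n) (Fin n) ℝ) (p₁ : ℝ) (X : E n) (u : L2) : ℝ :=
  ⟪X, act P X⟫_ℝ + p₁ * ‖S.zmap X u‖ ^ 2

theorem act_B (f₀ : ℝ) : act S.B (WithLp.toLp 2 fun _ => f₀) = f₀ • S.Bvec := by
  ext i; simp [act, Matrix.mulVec, dotProduct, Bvec, mul_comm]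

/-- The delayed terms do not transform into `a₂` times the delayed target unless `A₁ = a₂I`; the
remainder is what `ζ` measures. -/
theorem zmap_delay (Y : E n) (v : L2) : S.zmap (act S.A₁ Y) (S.a₂ • v) =
    S.a₂ • S.zmap Y v - besselT (S.a + S.c) (S.gammaOp (act (S.A₁ - S.a₂ • 1) Y)) := by
  have h : act (S.A₁ - S.a₂ • 1) Y = act S.A₁ Y - S.a₂ • Y := by
    ext i; simp [act, Matrix.sub_mulVec, Matrix.smul_mulVec]
  rw [zmap, zmap, h, ← map_smul, ← map_sub]
  congr 1
  simp only [bw, map_smul, map_sub, smul_sub]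
  abel

/-- The dissipation inequality along the target system. -/
theorem exists_dissipation {P : Matrix (Fin n) (Fin n) ℝ} (hP : P.PosDef)
    {r δ₀ δ₁ p₁ lam : ℝ} (hr : 0 < r) (hp₁ : 0 < p₁) (hlam₀ : 0 ≤ lam) (hlam₁ : lam ≤ 2 * p₁)
    (hΘ₁ : (-(S.Theta1 P p₁ lam r δ₀ δ₁)).PosDef)
    (hΘ₂ : (-(S.Theta2 p₁ lam r δ₀ δ₁)).PosDef) :
    ∃ ε > 0, ∀ (X Y : E n) (v g : L2) (f₀ : ℝ) (u : L2), u = f₀ • one + dint g →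
      (∀ (z₀ : ℝ) (gz : L2), S.zmap X u = z₀ • one + dint gz →
        z₀ + ∫ y in (0 : ℝ)..1, (1 - y) * gz y = 0) →
      2 * ⟪X, act P (act S.A X + act S.A₁ Y + f₀ • S.Bvec)⟫_ℝ +
        2 * p₁ * ⟪S.zmap X u, S.zmap (act S.A X + act S.A₁ Y + f₀ • S.Bvec)
          (g + S.a₂ • v + S.a • u)⟫_ℝ + 2 * δ₀ * S.lyap P p₁ X u - 2 * δ₁ * S.lyap P p₁ Y v ≤
      -ε * (‖X‖ ^ 2 + ‖S.zmap X u‖ ^ 2) := by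
  obtain ⟨ε₁, hε₁, H₁⟩ := exists_posDef_bound hΘ₁
  have hΘ₂' := hΘ₂
  rw [Theta2, show -2 * δ₁ * p₁ = -(2 * δ₁ * p₁) by ring] at hΘ₂'
  obtain ⟨ε₂, hε₂, H₂⟩ := exists_posDef_two_bound hΘ₂'
  refine ⟨min ε₁ ε₂, lt_min hε₁ hε₂, fun X Y v g f₀ u hu hbd => ?_⟩
  obtain ⟨gz, hz, hz'⟩ := S.zmap_affine X f₀ g
  rw [← hu] at hz hz'
  set z := S.zmap X u with hzdef
  set z₀ := f₀ - rowApply S.K X with hz₀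
  have hb := hbd z₀ gz hz
  have hG := inner_second_deriv hb
  have hG0 := sq_le_norm_prim_sq hb
  have hGw := wirtinger hb
  rw [← hz] at hG hGw
  set w := S.zmap Y v with hw
  set D := besselT (S.a + S.c) (S.gammaOp (act (S.A₁ - S.a₂ • 1) Y)) with hD
  have hDn : ‖D‖ ^ 2 ≤ S.zeta * ‖act (S.A₁ - S.a₂ • 1) Y‖ ^ 2 := S.norm_zmap_gamma_sq_le _
  have hder : S.zmap (act S.A X + act S.A₁ Y + f₀ • S.Bvec) (g + S.a₂ • v + S.a • u) =
      (gz - S.c • z) + (S.a₂ • w - D) := by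
    rw [← hz', hw, hD, ← zmap_delay, ← zmap_add]
    congr 1 <;> abel
  have hin : ⟪z, (gz - S.c • z) + (S.a₂ • w - D)⟫_ℝ =
      -‖prim gz‖ ^ 2 - S.c * ‖z‖ ^ 2 + S.a₂ * ⟪z, w⟫_ℝ - ⟪z, D⟫_ℝ := by
    rw [inner_add_right, inner_sub_right, inner_sub_right, inner_smul_right, inner_smul_right, hG,
      real_inner_self_eq_norm_sq]
    ring
  have hX' : act S.A X + act S.A₁ Y + f₀ • S.Bvec =
      act S.A X + rowApply S.K X • S.Bvec + act S.A₁ Y + z₀ • S.Bvec := by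
    rw [hz₀, sub_smul]; abel
  have h1 := H₁ (Sum.elim (Sum.elim X.ofLp Y.ofLp) (fun _ => z₀))
  rw [Matrix.neg_mulVec, dotProduct_neg, S.theta1_form P hP.1, ← hX', sumElim_dotProduct_sumElim,
    sumElim_dotProduct_sumElim, ← norm_sq_eq_dotProduct, ← norm_sq_eq_dotProduct] at h1
  have h1' : 0 ≤ ε₁ * ‖Y‖ ^ 2 := by positivity
  have h1'' : 0 ≤ ε₁ * ((fun _ : Fin 1 => z₀) ⬝ᵥ fun _ => z₀) := by
    refine mul_nonneg hε₁.le ?_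
    simpa [dotProduct] using mul_self_nonneg z₀
  have h2 := H₂ z w
  have h3 : -2 * ⟪z, D⟫_ℝ ≤ r * ‖z‖ ^ 2 + r⁻¹ * ‖D‖ ^ 2 := by
    have := abs_le.1 (abs_real_inner_le_norm z D)
    have h4 : 0 ≤ r⁻¹ * (r * ‖z‖ - ‖D‖) ^ 2 := by positivity
    have h5 : r⁻¹ * (r * ‖z‖ - ‖D‖) ^ 2 = r * ‖z‖ ^ 2 - 2 * (‖z‖ * ‖D‖) + r⁻¹ * ‖D‖ ^ 2 := by
      field_simp; ring
    linarith [this.1]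
  have h4 : p₁ * (-2 * ⟪z, D⟫_ℝ) ≤
      p₁ * (r * ‖z‖ ^ 2 + r⁻¹ * (S.zeta * ‖act (S.A₁ - S.a₂ • 1) Y‖ ^ 2)) := by
    refine mul_le_mul_of_nonneg_left (h3.trans ?_) hp₁.le
    have := mul_le_mul_of_nonneg_left hDn (inv_pos.2 hr).le
    linarith
  -- The dissipation `2p₁‖z'‖²` is split: the share `lam` dominates `lam z(0)²` needed for `Θ₁`, and
  -- the rest, `2p₁ - lam`, goes through Wirtinger into `Θ₂`.
  have h5 := mul_le_mul_of_nonneg_left hG0 hlam₀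
  have h6 := mul_le_mul_of_nonneg_left hGw (sub_nonneg.2 hlam₁)
  have h7 : min ε₁ ε₂ * ‖X‖ ^ 2 ≤ ε₁ * ‖X‖ ^ 2 :=
    mul_le_mul_of_nonneg_right (min_le_left _ _) (sq_nonneg _)
  have h8 : min ε₁ ε₂ * ‖z‖ ^ 2 ≤ ε₂ * ‖z‖ ^ 2 :=
    mul_le_mul_of_nonneg_right (min_le_right _ _) (sq_nonneg _)
  rw [hder, hin, lyap, lyap, ← hzdef, ← hw]
  linarith

/-! ### Estimates along solutions -/

/-- As a difference of bounded linear maps of `u` and of `X`, the target variable inherits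
continuity and differentiability in time. -/
theorem zmap_eq (X : E n) (u : L2) : S.zmap X u =
    (besselT (S.a + S.c) ∘L (ContinuousLinearMap.id ℝ L2 - S.kOp)) u -
      (besselT (S.a + S.c) ∘L S.gammaOp) X :=
  map_sub _ _ _

theorem hasDerivWithinAt_lyap {P : Matrix (Fin n) (Fin n) ℝ} (hP : P.IsHermitian) (p₁ : ℝ)
    {X : ℝ → E n} {u : ℝ → L2} {X' : E n} {u' : L2} {s : Set ℝ} {t : ℝ}
    (hX : HasDerivWithinAt X X' s t) (hu : HasDerivWithinAt u u' s t) :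
    HasDerivWithinAt (fun t => S.lyap P p₁ (X t) (u t))
      (2 * ⟪X t, act P X'⟫_ℝ + 2 * p₁ * ⟪S.zmap (X t) (u t), S.zmap X' u'⟫_ℝ) s t := by
  have h1 := hX.inner ℝ ((actL P).hasFDerivAt.comp_hasDerivWithinAt t hX)
  have hz : HasDerivWithinAt (fun t => S.zmap (X t) (u t)) (S.zmap X' u') s t := by
    simp only [zmap_eq]
    exact (ContinuousLinearMap.hasFDerivAt _).comp_hasDerivWithinAt t hu |>.sub
      ((ContinuousLinearMap.hasFDerivAt _).comp_hasDerivWithinAt t hX)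
  refine (h1.add (hz.norm_sq.const_mul p₁)).congr_deriv ?_
  simp only [Function.comp_apply, actL_apply]
  rw [inner_act_comm hP X' (X t)]
  ring

theorem continuousOn_lyap (P : Matrix (Fin n) (Fin n) ℝ) (p₁ : ℝ) {X : ℝ → E n} {u : ℝ → L2}
    {s : Set ℝ} (hX : ContinuousOn X s) (hu : ContinuousOn u s) :
    ContinuousOn (fun t => S.lyap P p₁ (X t) (u t)) s := by
  simp only [lyap, zmap_eq, ← actL_apply]
  fun_prop

theorem lyap_le {P : Matrix (Fin n) (Fin n) ℝ} {p₁ β : ℝ}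
    (hPβ : (β • (1 : Matrix (Fin n) (Fin n) ℝ) - P).PosSemidef) (hp₁β : p₁ ≤ β) (X : E n) (u : L2) :
    S.lyap P p₁ X u ≤ β * (‖X‖ ^ 2 + ‖S.zmap X u‖ ^ 2) := by
  have h1 := hPβ.dotProduct_mulVec_nonneg X.ofLp
  simp only [star_trivial, Matrix.sub_mulVec, Matrix.smul_mulVec, Matrix.one_mulVec, dotProduct_sub,
    dotProduct_smul, smul_eq_mul] at h1
  rw [← norm_sq_eq_dotProduct] at h1
  have h2 : ⟪X, act P X⟫_ℝ = X.ofLp ⬝ᵥ (P *ᵥ X.ofLp) := inner_eq_dotProduct _ _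
  have h3 := mul_le_mul_of_nonneg_right hp₁β (sq_nonneg ‖S.zmap X u‖)
  rw [lyap, h2]
  linarith

/-- `U² ≤ 2c₁²|X|² + 2c₂²‖z‖² ≤ ū²V ≤ ū²`; the factor `2` explains the `ū²/2` in the hypotheses. -/
theorem abs_feedback_le_of_lyap_le_one {P : Matrix (Fin n) (Fin n) ℝ} {p₁ ubar : ℝ}
    (hubar : 0 < ubar)
    (hPu : ((ubar ^ 2 / 2) • P - S.c1 ^ 2 • (1 : Matrix (Fin n) (Fin n) ℝ)).PosSemidef)
    (hp₁u : 0 ≤ p₁ * (ubar ^ 2 / 2) - S.c2 ^ 2) {X : E n} {u : L2} (h : S.lyap P p₁ X u ≤ 1) :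
    |S.feedback X u| ≤ ubar := by
  have h1 := hPu.dotProduct_mulVec_nonneg X.ofLp
  simp only [star_trivial, Matrix.sub_mulVec, Matrix.smul_mulVec, Matrix.one_mulVec, dotProduct_sub,
    dotProduct_smul, smul_eq_mul] at h1
  rw [← norm_sq_eq_dotProduct] at h1
  have h2 : ⟪X, act P X⟫_ℝ = X.ofLp ⬝ᵥ (P *ᵥ X.ofLp) := inner_eq_dotProduct _ _
  rw [lyap, h2] at h
  have h3 := mul_nonneg hp₁u (sq_nonneg ‖S.zmap X u‖)
  have h4 := mul_le_mul_of_nonneg_left h (sq_nonneg ubar)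
  refine (S.abs_feedback_le X u).trans (le_of_sq_le_sq ?_ hubar.le)
  nlinarith [sq_nonneg (S.c1 * ‖X‖ - S.c2 * ‖S.zmap X u‖)]

theorem lyap_le_one_of_mem_Xu {P : Matrix (Fin n) (Fin n) ℝ} {p₁ β h : ℝ} (hβ : 0 < β)
    (hPβ : (β • (1 : Matrix (Fin n) (Fin n) ℝ) - P).PosSemidef) (hp₁β : p₁ ≤ β)
    {X₀ : ℝ → E n} {u₀ : ℝ → L2} (h_init : (X₀, u₀) ∈ S.Xu h β) {θ : ℝ} (hθ : θ ∈ Icc (-h) 0) :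
    S.lyap P p₁ (X₀ θ) (u₀ θ) ≤ 1 := by
  obtain ⟨⟨hX, hu, _⟩, hM⟩ := h_init
  have h1 : ‖X₀ θ‖ ^ 2 ≤ sSup ((fun θ => ‖X₀ θ‖ ^ 2) '' Icc (-h) 0) :=
    le_csSup (isCompact_Icc.bddAbove_image (hX.continuousOn.norm.pow 2)) ⟨θ, hθ, rfl⟩
  have h2 : ‖u₀ θ‖ ^ 2 ≤ sSup ((fun θ => ‖u₀ θ‖ ^ 2) '' Icc (-h) 0) :=
    le_csSup (isCompact_Icc.bddAbove_image (hu.continuousOn.norm.pow 2)) ⟨θ, hθ, rfl⟩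
  have hM1 : 0 ≤ S.M1 := by rw [M1]; positivity
  have hM2 : 0 ≤ S.M2 := by rw [M2]; positivity
  have h3 := S.norm_zmap_sq_le (X₀ θ) (u₀ θ)
  have h4 := mul_le_mul_of_nonneg_left h1 hM1
  have h5 := mul_le_mul_of_nonneg_left h2 hM2
  have h6 : ‖X₀ θ‖ ^ 2 + ‖S.zmap (X₀ θ) (u₀ θ)‖ ^ 2 ≤ β⁻¹ := by
    simp only at hM
    linarith
  calc _ ≤ β * (‖X₀ θ‖ ^ 2 + ‖S.zmap (X₀ θ) (u₀ θ)‖ ^ 2) := S.lyap_le hPβ hp₁β _ _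
    _ ≤ β * β⁻¹ := mul_le_mul_of_nonneg_left h6 hβ.le
    _ = 1 := mul_inv_cancel₀ hβ.ne'

/-- `V` is coercive in `(X, z)`, and `u` is recovered boundedly from `(X, z)`. -/
theorem tendsto_norm_of_lyap {P : Matrix (Fin n) (Fin n) ℝ} (hP : P.PosDef) {p₁ : ℝ} (hp₁ : 0 < p₁)
    {X : ℝ → E n} {u : ℝ → L2}
    (h : Tendsto (fun t => S.lyap P p₁ (X t) (u t)) atTop (𝓝 0)) :
    Tendsto (fun t => ‖(WithLp.toLp 2 (X t, u t) : HSpace n)‖) atTop (𝓝 0) := by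
  obtain ⟨ε, hε, H⟩ := exists_posDef_bound hP
  have hPX : ∀ X : E n, ε * ‖X‖ ^ 2 ≤ ⟪X, act P X⟫_ℝ := fun X => by
    rw [inner_eq_dotProduct, norm_sq_eq_dotProduct]; exact H X.ofLp
  have hsqrt : ∀ f : ℝ → ℝ, Tendsto (fun t => f t ^ 2) atTop (𝓝 0) → (∀ t, 0 ≤ f t) →
      Tendsto f atTop (𝓝 0) := by
    intro f hf h0
    have := (Real.continuous_sqrt.tendsto 0).comp hf
    rw [Real.sqrt_zero] at this
    exact this.congr fun t => Real.sqrt_sq (h0 t)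
  have hX : Tendsto (fun t => ‖X t‖) atTop (𝓝 0) := by
    refine hsqrt _ (squeeze_zero (fun t => sq_nonneg _) (fun t => ?_)
      (by simpa using h.const_mul ε⁻¹)) fun t => norm_nonneg _
    rw [le_inv_mul_iff₀ hε, lyap]
    have := hPX (X t)
    have : 0 ≤ p₁ * ‖S.zmap (X t) (u t)‖ ^ 2 := by positivity
    linarith
  have hz : Tendsto (fun t => ‖S.zmap (X t) (u t)‖) atTop (𝓝 0) := by
    refine hsqrt _ (squeeze_zero (fun t => sq_nonneg _) (fun t => ?_)
      (by simpa using h.const_mul p₁⁻¹)) fun t => norm_nonneg _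
    rw [le_inv_mul_iff₀ hp₁, lyap]
    have := hPX (X t)
    have : 0 ≤ ε * ‖X t‖ ^ 2 := by positivity
    linarith
  obtain ⟨C, hC⟩ := S.exists_norm_le_zmap
  have hu : Tendsto (fun t => ‖u t‖) atTop (𝓝 0) :=
    squeeze_zero (fun t => norm_nonneg _) (fun t => hC (X t) (u t))
      (by simpa using (hX.add hz).const_mul C)
  have := (Real.continuous_sqrt.tendsto 0).comp (by simpa using (hX.pow 2).add (hu.pow 2))
  rw [Real.sqrt_zero] at this
  refine this.congr fun t => ?_
  rw [WithLp.prod_norm_eq_of_L2]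
  rfl

/-! ### Exponential decay along solutions. -/

theorem exists_decay_rate {δ h η : ℝ} (hη : 0 < η) :
    ∃ α > 0, α + 2 * δ * (Real.exp (α * h) - 1) < η := by
  have hc : Continuous fun α : ℝ => α + 2 * δ * (Real.exp (α * h) - 1) := by fun_prop
  have ht : Tendsto (fun α : ℝ => α + 2 * δ * (Real.exp (α * h) - 1)) (𝓝[>] 0) (𝓝 0) := by
    have := hc.tendsto 0
    simp only [zero_mul, Real.exp_zero, sub_self, mul_zero, add_zero] at this
    exact this.mono_left nhdsWithin_le_nhds
  obtain ⟨α, h1, h2⟩ := ((ht.eventually (gt_mem_nhds hη)).and self_mem_nhdsWithin).exists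
  exact ⟨α, h2, h1⟩

theorem lyap_le_exp {ubar : ℝ} (hubar : 0 < ubar) {r δ : ℝ} (hr : 0 < r) (hδ : 0 < δ)
    {P : Matrix (Fin n) (Fin n) ℝ} (hP : P.PosDef)
    {p₁ lam β : ℝ} (hp₁ : 0 < p₁) (hlam₀ : 0 ≤ lam) (hlam₁ : lam ≤ 2 * p₁) (hβ : 0 < β)
    (hΘ₁ : (-(S.Theta1 P p₁ lam r δ δ)).PosDef)
    (hΘ₂ : (-(S.Theta2 p₁ lam r δ δ)).PosDef)
    (hPβ : (β • (1 : Matrix (Fin n) (Fin n) ℝ) - P).PosSemidef) (hp₁β : p₁ ≤ β)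
    (hPu : ((ubar ^ 2 / 2) • P - S.c1 ^ 2 • (1 : Matrix (Fin n) (Fin n) ℝ)).PosSemidef)
    (hp₁u : 0 ≤ p₁ * (ubar ^ 2 / 2) - S.c2 ^ 2)
    {h : ℝ} (hh : 0 < h) {τ : ℝ → ℝ} (hτ : ∀ t : ℝ, 0 ≤ t → 0 ≤ τ t ∧ τ t ≤ h)
    {X₀ : ℝ → E n} {u₀ : ℝ → L2} (h_init : (X₀, u₀) ∈ S.Xu h β)
    {X : ℝ → E n} {u : ℝ → L2} (hsol : S.IsClassicalSolution ubar h τ X₀ u₀ X u) :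
    ∃ α > 0, ∀ t, 0 ≤ t → S.lyap P p₁ (X t) (u t) ≤ Real.exp (-α * t) := by
  obtain ⟨ε, hε, hdiss⟩ := S.exists_dissipation hP hr hp₁ hlam₀ hlam₁ hΘ₁ hΘ₂
  -- Since `V ≤ β(|X|² + ‖z‖²)`, the margin `ε` amounts to a decay rate `ε/β`; `α` is small enough
  -- that the growth `e^{αh}` over one delay stays within it.
  obtain ⟨α, hα, hrate⟩ := exists_decay_rate (δ := δ) (h := h) (div_pos hε hβ)
  have hexp : ∀ t, HasDerivAt (fun t => Real.exp (-α * t)) (-α * Real.exp (-α * t)) t := fun t => by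
    refine (((hasDerivAt_id t).const_mul (-α)).exp).congr_deriv ?_
    simp [mul_comm]
  have hinit : ∀ s ∈ Icc (-h) 0, S.lyap P p₁ (X s) (u s) ≤ Real.exp (-α * s) := by
    intro s hs
    obtain ⟨e1, e2⟩ := hsol.init s hs
    rw [e1, e2]
    refine (S.lyap_le_one_of_mem_Xu hβ hPβ hp₁β h_init hs).trans (Real.one_le_exp ?_)
    nlinarith [hs.2]
  have h00 : (0 : ℝ) ∈ Icc (-h) 0 := ⟨by linarith, le_rfl⟩
  refine ⟨α, hα, fun t ht => le_of_crossing (h := h)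
    (S.continuousOn_lyap P p₁ hsol.contDiff_X.continuousOn hsol.contDiff_u.continuousOn) hexp hinit
    (hinit 0 h00) (fun t ht hall heq => ?_) ht⟩
  obtain ⟨f, f', g, hH2, hf'0, hbc, hX', hu'⟩ := hsol.equations t ht
  rw [act_B] at hX'
  have hV1 : S.lyap P p₁ (X t) (u t) ≤ 1 := by
    rw [heq]
    exact Real.exp_le_one_iff.2 (by nlinarith)
  have hf1 : f 1 = S.feedback (X t) (u t) := by
    -- At `t = 0` the solution is not required to satisfy the boundary condition; it comes from the
    -- compatibility condition in `W₁`. For `t > 0`, `V ≤ 1` makes the saturation inactive.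
    rcases ht.eq_or_lt with h0 | hpos
    · obtain ⟨⟨_, _, _, _, hW⟩, _⟩ := h_init
      obtain ⟨F, F', hF, hF0, hF1⟩ := hW 0 h00
      obtain ⟨e1, e2⟩ := hsol.init 0 h00
      rw [← h0] at hH2 ⊢
      simp only at hF hF1
      rw [← e2] at hF hF1
      rw [← e1] at hF1
      rw [← hF1]
      exact eqOn_of_ae_unit (hH2.ae_eq.symm.trans hF.ae_eq) (hH2.continuousOn hf'0)
        (hF.continuousOn hF0) (right_mem_Icc.2 zero_le_one)
    · rw [hbc hpos]
      exact sat_eq_self (S.abs_feedback_le_of_lyap_le_one hubar hPu hp₁u hV1)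
  refine ⟨_, S.hasDerivWithinAt_lyap hP.1 p₁ hX' hu', ?_⟩
  have hd := hdiss (X t) (X (t - τ t)) (u (t - τ t)) g (f 0) (u t) (hH2.class_eq hf'0)
    fun z₀ gz hz => S.zmap_boundary hH2 hf'0 hf1 hz
  have hle := S.lyap_le hPβ hp₁β (X t) (u t)
  have hle' : ε / β * S.lyap P p₁ (X t) (u t) ≤ ε * (‖X t‖ ^ 2 + ‖S.zmap (X t) (u t)‖ ^ 2) := by
    rw [div_mul_eq_mul_div, div_le_iff₀ hβ]
    nlinarith
  obtain ⟨hτ0, hτh⟩ := hτ t ht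
  -- The delayed time lies in the controlled past, possibly in `[-h, 0]`, and `τ ≤ h` costs at most
  -- the factor `e^{αh}`.
  have hpast : S.lyap P p₁ (X (t - τ t)) (u (t - τ t)) ≤ Real.exp (α * h) * Real.exp (-α * t) := by
    refine (hall (t - τ t) ⟨by linarith, by linarith⟩).trans ?_
    rw [← Real.exp_add]
    refine Real.exp_le_exp.2 ?_
    nlinarith
  have hpast' := mul_le_mul_of_nonneg_left hpast (show 0 ≤ 2 * δ by linarith)
  have hstrict := mul_lt_mul_of_pos_right hrate (Real.exp_pos (-α * t))
  rw [heq] at hd hle'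
  linarith

end Data

end

end HeatODE

/-! ### Conclusion: convergence to zero. -/

theorem mainTheorem3 (n : ℕ) (S : HeatODE.Data n) (hc : 0 < S.c)
    (ubar : ℝ) (hubar : 0 < ubar)
    (r δ₀ δ₁ : ℝ) (hr : 0 < r) (hδ₁ : 0 < δ₁) (hδ : δ₁ = δ₀)
    (P : Matrix (Fin n) (Fin n) ℝ) (hP : P.PosDef)
    (p₁ lam β : ℝ) (hp₁ : 0 < p₁) (hlam₀ : 0 ≤ lam) (hlam₁ : lam ≤ 2 * p₁) (hβ : 0 < β)
    (hΘ₁ : (-(S.Theta1 P p₁ lam r δ₀ δ₁)).PosDef)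
    (hΘ₂ : (-(S.Theta2 p₁ lam r δ₀ δ₁)).PosDef)
    (hPβ : (β • (1 : Matrix (Fin n) (Fin n) ℝ) - P).PosSemidef) (hp₁β : p₁ ≤ β)
    (hPu : ((ubar ^ 2 / 2) • P - S.c1 ^ 2 • (1 : Matrix (Fin n) (Fin n) ℝ)).PosSemidef)
    (hp₁u : 0 ≤ p₁ * (ubar ^ 2 / 2) - S.c2 ^ 2)
    (h₀ h : ℝ) (hh₀ : 0 < h₀) (hh : 0 < h)
    (τ : ℝ → ℝ) (hτ : ContDiffOn ℝ 1 τ (Set.Ici 0))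
    (hτ_bd : ∀ t : ℝ, 0 ≤ t → h₀ ≤ τ t ∧ τ t ≤ h)
    (X₀ : ℝ → HeatODE.E n) (u₀ : ℝ → HeatODE.L2) (h_init : (X₀, u₀) ∈ S.Xu h β)
    (X : ℝ → HeatODE.E n) (u : ℝ → HeatODE.L2)
    (hsol : S.IsClassicalSolution ubar h τ X₀ u₀ X u) :
    Filter.Tendsto (fun t => ‖(WithLp.toLp 2 (X t, u t) : HeatODE.HSpace n)‖)
      Filter.atTop (nhds 0) := by
  subst hδ
  obtain ⟨α, hα, hdecay⟩ := S.lyap_le_exp hubar hr hδ₁ hP hp₁ hlam₀ hlam₁ hβ hΘ₁ hΘ₂ hPβ hp₁β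
    hPu hp₁u hh (fun t ht => ⟨hh₀.le.trans (hτ_bd t ht).1, (hτ_bd t ht).2⟩) h_init hsol
  refine S.tendsto_norm_of_lyap hP hp₁ ?_
  have hexp : Filter.Tendsto (fun t : ℝ => Real.exp (-α * t)) Filter.atTop (nhds 0) :=
    Real.tendsto_exp_atBot.comp (Filter.tendsto_id.const_mul_atTop_of_neg (neg_neg_iff_pos.2 hα))
  refine squeeze_zero' (Filter.Eventually.of_forall fun t => ?_)
    ((Filter.eventually_ge_atTop 0).mono hdecay) hexp
  have hX : 0 ≤ inner ℝ (X t) (HeatODE.act P (X t)) := by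
    rw [HeatODE.inner_eq_dotProduct]
    exact hP.posSemidef.dotProduct_mulVec_nonneg (X t).ofLp
  exact add_nonneg hX (mul_nonneg hp₁.le (sq_nonneg _))
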